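/- **Conventions.** Let $p$ be a prime. For $n\in\mathbb Z$ and a positive integer $d$ let $\mathrm{quo}(n,d)$ and $\mathrm{rem}(n,d)$ be the quotient and the remainder of $n$ on division by $d$, with $0\le\mathrm{rem}(n,d)<d$; $\lfloor\cdot\rfloor$ is the floor function. A partition is a nonincreasing sequence $\lambda=(\lambda_1,\lambda_2,\dots)$ of nonnegative integers with finite sum; its height $h(\lambda)$ is the number of its nonzero parts; it is $p$-regular if no nonzero part occurs $p$ or more times; $\nu\trianglelefteq\mu$ means $\sum_{j\le k}\nu_j\le\sum_{j\le k}\mu_j$ for all $k\ge1$. **Mullineux map.** The rim of $\lambda$ is the set of nodes $(a,b)$ of its Young diagram with $(a+1,b+1)$ outside the diagram. Reading the rim from the top right to the bottom left, the first $p$-segment consists of its first $p$ nodes (of all of them, if there are fewer than $p$), and each next $p$-segment consists of $p$ consecutive rim nodes (of all remaining ones, if there are fewer than $p$) starting with the rightmost node of the row following the last row of the previous segment. The $p$-edge is the union of the $p$-segments, $e(\lambda)$ is its number of nodes and $\varphi(\lambda)$ is the partition obtained by removing it. With $A_j=e(\varphi^j(\lambda))$ and $R_j=h(\varphi^j(\lambda))$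 for $j\ge0$, the array with columns $\binom{A_j}{R_j}$ is the Mullineux symbol of $\lambda$. The Mullineux map $m$ sends a $p$-regular partition $\lambda$ to the unique $p$-regular partition $m(\lambda)$ whose Mullineux symbol has the columns $\binom{A_j}{A_j-R_j+\varepsilon_j}$, where $\varepsilon_j=0$ if $p\mid A_j$ and $\varepsilon_j=1$ otherwise. **Abaci.** An abacus is a set $\Lambda\subset\mathbb Z$ (of "beads") containing all sufficiently small integers and no sufficiently large ones; the other integers are its spaces. If $a_1>a_2>\cdots$ are all its beads, its partition $P(\Lambda)$ has $k$-th part equal to the number of spaces less than $a_k$. A bead is proper if some space is less than it. For $x\in\mathbb Z$, $S\subset[0,p-1]$ and $i\ge0$, let $x_0<x_1<\cdots$ be all integers $n\ge x$ with $\mathrm{rem}(n,p)\in S$, and put $\langle x,S,i\rangle=\{x_k: i\le k<i+|S|\}$. For integers $0<i\le h<p$ and $x\ge0$ put $$\Lambda^{(h,i,x)}=(-\infty,0)\cup\langle 0,[0,i),x\rangle\cup[i,h),\qquad \lambda^{(h,i,x)}=P(\Lambda^{(h,i,x)}),$$ (intervals of integers) and $\Lambda^{(H,x)}=\Lambda^{(H,H,x)}$,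 $\lambda^{(H,x)}=\lambda^{(H,H,x)}$. For $1<H<p$ and $H\nmid x$, let $a$ be the greatest bead and $b$ the smallest proper bead of $\Lambda^{(H,x)}$; let $\widetilde{\lambda^{(H,x)}}$ be the partition of the abacus obtained from $\Lambda^{(H,x)}$ by moving $a$ to the position $a-p$ and $b$ to the position $b+p$. **Theorem 6.8.** Let $H,x,i$ be integers with $1<H<p$ and $H\nmid x$. Put $Q=\mathrm{quo}(x,H)$, $R=\mathrm{rem}(x,H)$, $h=H-R$, and suppose that $0<i\le x$ and $i\le h$. Put $m_0=\max\{i,\,i+h-x\}$. Then the following conditions are equivalent: 1. $m\bigl(\widetilde{\lambda^{(H,x)}}\bigr)\trianglelefteq m\bigl(\lambda^{(h,i,x)}\bigr)$; 2. $\displaystyle m_0\left\lfloor\frac{p-h+x-1}{p-m_0}\right\rfloor\ \ge\ H-Q-1+h\left\lfloor\frac{x-Q-1}{p-H+1}\right\rfloor+(R-1)\left\lfloor\frac{x-Q-2}{p-H+1}\right\rfloor.$ -/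

import Mathlib

namespace Mullineux

/-- A partition: an infinite nonincreasing sequence of nonnegative integers which is eventually zero
(equivalently, whose sum is finite).  The entry `part k` is the part `λ_{k+1}`. -/
@[ext]
structure Ptn where
  part : ℕ → ℕ
  anti : Antitone part
  fin : ∃ N, part N = 0

namespace Ptn

/-- The height: the number of nonzero parts, i.e. the first (zero-based) index of a zero part. -/
def height (l : Ptn) : ℕ := Nat.find l.fin

/-- A partition is `p`-regular if no nonzero part occurs `p` or more times. -/
def IsRegular (p : ℕ) (l : Ptn) : Prop :=
  ∀ a : ℕ, 0 < a → Set.ncard {k | l.part k = a} < p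

/-- `l.Dominates m`: every partial sum of `l` is at least the corresponding partial sum of `m`. -/
def Dominates (l m : Ptn) : Prop :=
  ∀ i : ℕ, ∑ j ∈ Finset.range i, m.part j ≤ ∑ j ∈ Finset.range i, l.part j

/-- The number of nodes of the rim in a given row.  The rim consists of the nodes `(i, j)` of the
diagram such that `(i + 1, j + 1)` is not in the diagram; in a nonzero row these are the nodes with
`max (λ_{i+1}) 1 ≤ j ≤ λ_i`. -/
def rimRow (l : Ptn) (k : ℕ) : ℕ :=
  if l.part k = 0 then 0 else l.part k + 1 - max (l.part (k + 1)) 1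

/-- The `p`-edge is the union of the `p`-segments of the rim.  The rim is read from the top right to
the bottom left.  The first `p`-segment consists of the first `p` nodes of the rim; each next one
consists of the `p` consecutive nodes of the rim starting at the rightmost node of the row that
follows the last row of the previous segment; the last segment may have fewer than `p` nodes.

`edgeLeft p l k` is the number of nodes that the segment current at the beginning of row `k` can
still receive: it is `p` if a new segment starts in row `k`. -/
def edgeLeft (p : ℕ) (l : Ptn) : ℕ → ℕ
  | 0 => p
  | k + 1 =>
    if edgeLeft p l k - l.rimRow k = 0 then p else edgeLeft p l k - l.rimRow k

/-- The number of nodes of the `p`-edge in a given row (they are the rightmost ones of the row). -/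
def edgeRow (p : ℕ) (l : Ptn) (k : ℕ) : ℕ := min (edgeLeft p l k) (l.rimRow k)

/-- The number of nodes in the `p`-edge. -/
def e (p : ℕ) (l : Ptn) : ℕ := ∑ k ∈ Finset.range l.height, edgeRow p l k

theorem edgeLeft_zero (l : Ptn) (k : ℕ) : edgeLeft 0 l k = 0 := by
  induction k with
  | zero => rfl
  | succ k ih => simp [edgeLeft, ih]

theorem edgeLeft_pos {p : ℕ} (hp : 0 < p) (l : Ptn) (k : ℕ) : 0 < edgeLeft p l k := by
  induction k with
  | zero => exact hp
  | succ k ih =>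
    rw [edgeLeft]
    split_ifs with h <;> omega

theorem anti_sub_edgeRow (p : ℕ) (l : Ptn) : Antitone fun k => l.part k - edgeRow p l k := by
  refine antitone_nat_of_succ_le fun k => ?_
  have h1 := l.anti (Nat.le_succ k)
  have h2 := l.anti (Nat.le_succ (k + 1))
  simp only [Nat.succ_eq_add_one] at h1 h2
  rcases Nat.eq_zero_or_pos p with rfl | hp
  · simpa [edgeRow, edgeLeft_zero] using h1
  · have e1 := edgeLeft_pos hp l k
    have e2 := edgeLeft_pos hp l (k + 1)
    simp only [edgeRow, rimRow]
    split_ifs <;> omega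

/-- The partition obtained by removing the `p`-edge. -/
def phi (p : ℕ) (l : Ptn) : Ptn where
  part k := l.part k - edgeRow p l k
  anti := anti_sub_edgeRow p l
  fin := by
    obtain ⟨N, hN⟩ := l.fin
    exact ⟨N, by simp [hN]⟩

/-- The upper row of the Mullineux symbol: `A_j = e (φ^j(λ))`, continued by zeros. -/
def symA (p : ℕ) (l : Ptn) (j : ℕ) : ℕ := e p ((phi p)^[j] l)

/-- The lower row of the Mullineux symbol: `R_j = h (φ^j(λ))`, continued by zeros. -/
def symR (p : ℕ) (l : Ptn) (j : ℕ) : ℕ := height ((phi p)^[j] l)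

/-- `m` is the `p`-regular partition whose Mullineux symbol has the columns
`(A_j, A_j - R_j + ε_j)`, where `(A_j, R_j)` are the columns of the Mullineux symbol of `l` and
`ε_j` is `0` or `1` according to whether `p` divides `A_j` or not. -/
def IsMullineuxImage (p : ℕ) (l m : Ptn) : Prop :=
  m.IsRegular p ∧
    ∀ j, symA p m j = symA p l j ∧
      symR p m j + symR p l j = symA p l j + if p ∣ symA p l j then 0 else 1

open Classical in
/-- The Mullineux map.  Every `p`-regular partition has exactly one Mullineux image; the value on
other partitions is irrelevant. -/
noncomputable def mullineux (p : ℕ) (l : Ptn) : Ptn :=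
  if h : ∃ m, IsMullineuxImage p l m then h.choose else l

end Ptn

/-- An abacus `ℤ → {0, 1}`, given by its set of beads: all sufficiently small integers are beads and
all sufficiently large integers are spaces. -/
@[ext]
structure Abacus where
  bead : Set ℤ
  bound : ∃ N : ℤ, (∀ n, n ≤ -N → n ∈ bead) ∧ ∀ n, N ≤ n → n ∉ bead

namespace Abacus

/-- The beads in descending order: `nthBead 0 > nthBead 1 > ...`. -/
noncomputable def nthBead (L : Abacus) : ℕ → ℤ
  | 0 => sSup L.bead
  | k + 1 => sSup {n | n ∈ L.bead ∧ n < nthBead L k}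

theorem bddAbove (L : Abacus) : BddAbove L.bead := by
  obtain ⟨N, -, h⟩ := L.bound
  exact ⟨N, fun n hn => le_of_not_ge fun hc => h n hc hn⟩

theorem nthBead_succ_lt (L : Abacus) (k : ℕ) : nthBead L (k + 1) < nthBead L k := by
  obtain ⟨N, h, -⟩ := L.bound
  have hne : {n | n ∈ L.bead ∧ n < nthBead L k}.Nonempty :=
    ⟨min (-N) (nthBead L k - 1), h _ (min_le_left _ _),
      lt_of_le_of_lt (min_le_right _ _) (by omega)⟩
  exact (Int.csSup_mem hne (L.bddAbove.mono fun n hn => hn.1)).2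

theorem finite_spaces (L : Abacus) (a : ℤ) : {n | n ∉ L.bead ∧ n ≤ a}.Finite := by
  obtain ⟨N, h, -⟩ := L.bound
  refine (Set.finite_Icc (-N) a).subset fun n hn => ⟨?_, hn.2⟩
  exact le_of_not_ge fun hc => hn.1 (h n hc)

theorem nthBead_le (L : Abacus) (k : ℕ) : nthBead L k ≤ nthBead L 0 - k := by
  induction k with
  | zero => simp
  | succ k ih =>
    have := nthBead_succ_lt L k
    push_cast
    omega

/-- The partition of an abacus: if `a_1 > a_2 > ...` are all the beads, then `λ_i` is the number of
spaces `n ≤ a_i`. -/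
noncomputable def toPtn (L : Abacus) : Ptn where
  part k := Set.ncard {n | n ∉ L.bead ∧ n ≤ nthBead L k}
  anti := by
    refine antitone_nat_of_succ_le fun k => ?_
    refine Set.ncard_le_ncard (fun n hn => ⟨hn.1, ?_⟩) (finite_spaces L _)
    exact hn.2.trans (nthBead_succ_lt L k).le
  fin := by
    obtain ⟨N, h, -⟩ := L.bound
    refine ⟨(nthBead L 0 + N).toNat, ?_⟩
    have h1 := nthBead_le L (nthBead L 0 + N).toNat
    have h2 := Int.self_le_toNat (nthBead L 0 + N)
    have h3 : {n | n ∉ L.bead ∧ n ≤ nthBead L (nthBead L 0 + N).toNat} = ∅ := by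
      ext n
      simp only [Set.mem_ofPred_eq, Set.mem_empty_iff_false, iff_false, not_and, not_le]
      intro hn
      by_contra hc
      exact hn (h n (by omega))
    rw [h3, Set.ncard_empty]

/-- The greatest bead. -/
noncomputable def topBead (L : Abacus) : ℤ := sSup L.bead

/-- The smallest proper bead; a bead is proper if there is a space strictly less than it. -/
noncomputable def lowBead (L : Abacus) : ℤ :=
  sInf {n | n ∈ L.bead ∧ ∃ b, b ∉ L.bead ∧ b < n}

/-- The operation `Λ ↦ Λ~` on big abaci: the greatest bead `a` is moved to the position `a - p` and
the smallest proper bead `b` is moved to the position `b + p`. -/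
noncomputable def tilde (p : ℕ) (L : Abacus) : Abacus where
  bead := (L.bead \ {L.topBead, L.lowBead}) ∪ {L.topBead - p, L.lowBead + p}
  bound := by
    obtain ⟨N, h1, h2⟩ := L.bound
    refine ⟨|N| + |L.topBead| + |L.lowBead| + p + 1, fun n hn => ?_, fun n hn => ?_⟩
    · have a1 := le_abs_self N
      have a2 := neg_abs_le L.topBead
      have a3 := neg_abs_le L.lowBead
      have a4 := abs_nonneg L.topBead
      have a5 := abs_nonneg L.lowBead
      have a6 := abs_nonneg N
      refine Or.inl ⟨h1 n (by omega), ?_⟩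
      simp only [Set.mem_insert_iff, Set.mem_singleton_iff]
      omega
    · have a1 := le_abs_self N
      have a2 := le_abs_self L.topBead
      have a3 := le_abs_self L.lowBead
      have a4 := abs_nonneg L.topBead
      have a5 := abs_nonneg L.lowBead
      have a6 := abs_nonneg N
      rintro (⟨hn1, -⟩ | hn1)
      · exact h2 n (by omega) hn1
      · simp only [Set.mem_insert_iff, Set.mem_singleton_iff] at hn1
        omega

end Abacus

/-- The integers `n ≥ x` whose remainder modulo `p` belongs to `S`. -/
def runners (p : ℕ) (x : ℤ) (S : Set ℤ) : Set ℤ := {n | x ≤ n ∧ n % (p : ℤ) ∈ S}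

/-- The set `⟨x, S, i⟩ = {x_k : i ≤ k < i + |S|}`, where `x_0 < x_1 < ...` are all the elements of
`runners p x S`.  The index of an element is the number of smaller elements. -/
def segment (p : ℕ) (x : ℤ) (S : Set ℤ) (i : ℕ) : Set ℤ :=
  {n | n ∈ runners p x S ∧
    i ≤ Set.ncard {m | m ∈ runners p x S ∧ m < n} ∧
    Set.ncard {m | m ∈ runners p x S ∧ m < n} < i + S.ncard}

theorem segment_finite (p : ℕ) (x : ℤ) (S : Set ℤ) (i : ℕ) : (segment p x S i).Finite := by
  refine Set.Finite.of_finite_image (f := fun n => Set.ncard {m | m ∈ runners p x S ∧ m < n})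
    ((Set.finite_Iio (i + S.ncard)).subset ?_) ?_
  · rintro _ ⟨n, hn, rfl⟩
    exact hn.2.2
  · have key : ∀ a ∈ segment p x S i, ∀ b : ℤ, a < b →
        Set.ncard {m | m ∈ runners p x S ∧ m < a} < Set.ncard {m | m ∈ runners p x S ∧ m < b} := by
      intro a ha b hab
      refine Set.ncard_lt_ncard ⟨fun m hm => ⟨hm.1, hm.2.trans hab⟩, fun hs => ?_⟩ ?_
      · exact lt_irrefl a (hs (show a ∈ _ from ⟨ha.1, hab⟩)).2
      · exact (Set.finite_Icc x b).subset fun m hm => ⟨hm.1.1, hm.2.le⟩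
    intro a ha b hb hab
    simp only at hab
    rcases lt_trichotomy a b with h | h | h
    · exact absurd (key a ha b h) (by omega)
    · exact h
    · exact absurd (key b hb a h) (by omega)

/-- The abacus `Λ^{(h,i,x)}` with the set of beads `(-∞,0) ∪ ⟨0,[0,i),x⟩ ∪ [i,h)`. -/
def lamAbacus (p h i x : ℕ) : Abacus where
  bead := Set.Iio 0 ∪ segment p 0 (Set.Ico 0 (i : ℤ)) x ∪ Set.Ico (i : ℤ) h
  bound := by
    obtain ⟨B, hB⟩ := (segment_finite p 0 (Set.Ico 0 (i : ℤ)) x).bddAbove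
    refine ⟨|B| + h + 1, fun n hn => ?_, fun n hn => ?_⟩
    · have := abs_nonneg B
      exact Or.inl (Or.inl (show n < 0 by omega))
    · have h0 := abs_nonneg B
      have h1 := le_abs_self B
      rintro ((h2 | h2) | h2)
      · have h3 : n < 0 := h2
        omega
      · have h3 : n ≤ B := hB h2
        omega
      · have h3 : n < h := h2.2
        omega

/-- The partition `λ^{(h,i,x)} = P(Λ^{(h,i,x)})`. -/
noncomputable def lam (p h i x : ℕ) : Ptn := (lamAbacus p h i x).toPtn

/-- The partition obtained by applying `~` to `λ^{(H,x)} = λ^{(H,H,x)}`: the partition of the abacus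
obtained by applying `~` to `Λ^{(H,H,x)}`. -/
noncomputable def lamTilde (p H x : ℕ) : Ptn := ((lamAbacus p H H x).tilde p).toPtn

end Mullineux

/-! A partition is handled through its set of beads. Removing the `p`-edge moves the greatest bead
`t` to `t - p`, then the greatest bead not above `t - p` down by `p`, and so on; the last bead stops
at the first space if it would fall below it. Hence a window of `s` consecutive positions on a union
of `s` runners slides down by one place and loses `p` nodes (`edgeStep_window`).

The bead sets in question consist of an initial ray, a short block or a lower window, and an upper
window. Their Mullineux images have the same shape, with `s'` runners in place of `s`, where `s + s'
= p` for the final windows. The symbols of a partition and of its candidate image are compared edge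
by edge: both windows slide, both blocks shrink, and the two heights add up to `A + ε` at each step.
The process ends at sets whose greatest bead is less than `p` above the first space; there the
Mullineux map is conjugation, which reflects the complement of the bead set (`beadDual_reflect`). As
the symbol determines the partition (`eq_of_symbol_eq`) and the candidates are regular, this
identifies both images (`beadDual_lam`, `beadDual_lamTilde`).

The parts of the images can then be read off. Both images have size `p * x`. Below its first `p - H
+ 1` rows, the image of the modified partition has nonzero parts taking only two neighbouring
values, so the other image can fall below it only once and for good (`dominates_of_le_of_flat`); in
the first `p - H + 1` rows everything follows from row `0` (`part_le_part_of_part_zero_le`).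
Dominance is therefore a comparison of first parts, and these are `x` plus the two sides of the
inequality. -/

namespace Mullineux
-- Removal of the `p`-edge in terms of bead positions
namespace Ptn

/-- The position of the `k`-th bead in the abacus of `l` of charge zero. -/
def bd (l : Ptn) (k : ℕ) : ℤ := l.part k - k

theorem bd_strictAnti (l : Ptn) : StrictAnti l.bd := by
  refine strictAnti_nat_of_succ_lt fun k => ?_
  have := l.anti (Nat.le_succ k)
  simp only [bd, Nat.succ_eq_add_one] at *
  push_cast
  omega

theorem part_eq_zero_iff (l : Ptn) (k : ℕ) : l.part k = 0 ↔ l.height ≤ k := by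
  constructor
  · exact fun h => Nat.find_min' l.fin h
  · intro h
    have h1 : l.part l.height = 0 := Nat.find_spec l.fin
    have := l.anti h
    omega

theorem bd_of_height_le {l : Ptn} {k : ℕ} (h : l.height ≤ k) : l.bd k = -k := by
  simp [bd, (part_eq_zero_iff l k).2 h]

theorem lt_bd_of_lt_height {l : Ptn} {k : ℕ} (h : k < l.height) : 1 - (l.height : ℤ) < l.bd k := by
  have : l.part k ≠ 0 := fun h' => by
    have := (part_eq_zero_iff l k).1 h'
    omega
  simp only [bd]
  omega

/-- The position of the `k`-th bead, cut off below at the first space. -/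
def cutBd (l : Ptn) (k : ℕ) : ℤ := max (l.bd k) (1 - l.height)

theorem cutBd_of_lt {l : Ptn} {k : ℕ} (h : k < l.height) : l.cutBd k = l.bd k :=
  max_eq_left (lt_bd_of_lt_height h).le

theorem cutBd_height (l : Ptn) : l.cutBd l.height = 1 - l.height := by
  rw [cutBd, bd_of_height_le le_rfl]
  omega

/-- The cut-off at the first space plays the role of the `max _ 1` in `rimRow`, so that the last
nonzero row needs no separate formula. -/
theorem rimRow_eq {l : Ptn} {k : ℕ} (h : k < l.height) :
    (l.rimRow k : ℤ) = l.cutBd k - l.cutBd (k + 1) := by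
  have h0 : l.part k ≠ 0 := fun h' => by
    have := (part_eq_zero_iff l k).1 h'
    omega
  have h1 := l.anti (Nat.le_succ k)
  rw [cutBd_of_lt h]
  simp only [rimRow, h0, if_false, Nat.succ_eq_add_one] at *
  rcases Nat.lt_or_ge (k + 1) l.height with h2 | h2
  · have h3 : l.part (k + 1) ≠ 0 := fun h' => by
      have := (part_eq_zero_iff l (k + 1)).1 h'
      omega
    rw [cutBd_of_lt h2]
    simp only [bd]
    omega
  · have h3 : k + 1 = l.height := by omega
    have h4 := (part_eq_zero_iff l (k + 1)).2 h2
    rw [h3, cutBd_height, ← h3, h4]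
    simp only [bd]
    omega

/-- The position to which the bead starting the segment current at row `k` moves when the `p`-edge
is removed. -/
def target (p : ℕ) (l : Ptn) (k : ℕ) : ℤ := l.cutBd k - edgeLeft p l k

theorem target_zero (p : ℕ) (l : Ptn) : target p l 0 = l.cutBd 0 - p := rfl

/-- Inside a segment the capacity left decreases exactly as the bead position does, so their
difference is constant; the segment is exhausted once the next bead is not above the target. -/
theorem target_succ {p : ℕ} {l : Ptn} {k : ℕ} (h : k < l.height) :
    target p l (k + 1) =
      if l.cutBd (k + 1) ≤ target p l k then l.cutBd (k + 1) - p else target p l k := by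
  have h1 := rimRow_eq h
  simp only [target, edgeLeft]
  split_ifs <;> omega

theorem edgeRow_eq {p : ℕ} {l : Ptn} {k : ℕ} (h : k < l.height) :
    (edgeRow p l k : ℤ) = l.cutBd k - max (target p l k) (l.cutBd (k + 1)) := by
  have h1 := rimRow_eq h
  simp only [target, edgeRow]
  omega

theorem edgeRow_le (p : ℕ) (l : Ptn) (k : ℕ) : edgeRow p l k ≤ l.part k := by
  simp only [edgeRow, rimRow]
  split_ifs <;> omega

/-- Rows inside a segment take over the bead of the next row, and the last row of the segment
receives the target: as a set, only the starting bead of each segment moves. -/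
theorem bd_phi {p : ℕ} {l : Ptn} {k : ℕ} (h : k < l.height) :
    (phi p l).bd k = max (target p l k) (l.cutBd (k + 1)) := by
  have h1 := edgeRow_eq (p := p) h
  have h2 := edgeRow_le p l k
  rw [cutBd_of_lt h] at h1
  simp only [bd, phi] at *
  omega

theorem bd_phi_of_le {p : ℕ} {l : Ptn} {k : ℕ} (h : l.height ≤ k) :
    (phi p l).bd k = l.bd k := by
  have := (part_eq_zero_iff l k).2 h
  simp [bd, phi, this]

theorem ext_bd {l m : Ptn} (h : ∀ k, l.bd k = m.bd k) : l = m := by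
  ext k
  have := h k
  simp only [bd] at this
  omega

/-! ### The symbol determines the partition -/

theorem edgeLeft_le (p : ℕ) (l : Ptn) (k : ℕ) : edgeLeft p l k ≤ p := by
  induction k with
  | zero => exact le_rfl
  | succ k ih => rw [edgeLeft]; split_ifs <;> omega

theorem dvd_edgeLeft_add_sum (p : ℕ) (l : Ptn) (k : ℕ) :
    p ∣ edgeLeft p l k + ∑ j ∈ Finset.range k, edgeRow p l j := by
  induction k with
  | zero => simp [edgeLeft]
  | succ k ih =>
    rw [Finset.sum_range_succ, edgeLeft]
    simp only [edgeRow] at *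
    split_ifs with h
    · rw [min_eq_left (by omega)]
      have : p + (∑ j ∈ Finset.range k, min (edgeLeft p l j) (l.rimRow j) + edgeLeft p l k) =
        p + (edgeLeft p l k + ∑ j ∈ Finset.range k, min (edgeLeft p l j) (l.rimRow j)) := by ring
      rw [this]
      exact (Nat.dvd_add_right dvd_rfl).2 ih
    · rw [min_eq_right (by omega)]
      convert ih using 1
      omega

/-- The remaining capacity lies in `[1, p]` and is congruent to `-e` modulo `p`. -/
theorem edgeLeft_height_eq {p : ℕ} (hp : 0 < p) {l m : Ptn} (he : e p l = e p m) :
    edgeLeft p l l.height = edgeLeft p m m.height := by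
  have h1 := dvd_edgeLeft_add_sum p l l.height
  have h2 := dvd_edgeLeft_add_sum p m m.height
  have a1 := edgeLeft_pos hp l l.height
  have a2 := edgeLeft_pos hp m m.height
  have b1 := edgeLeft_le p l l.height
  have b2 := edgeLeft_le p m m.height
  unfold e at he
  rw [he] at h1
  have h3 := (Nat.dvd_sub h1 h2)
  have h4 := (Nat.dvd_sub h2 h1)
  rw [Nat.add_sub_add_right] at h3 h4
  by_contra hne
  rcases Nat.lt_or_gt_of_ne hne with h | h
  · have := Nat.le_of_dvd (by omega) h4
    omega
  · have := Nat.le_of_dvd (by omega) h3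
    omega

/-- The beads and targets of `l` are determined, from the bottom row upwards, by those of
`phi p l`. -/
theorem cutBd_and_target_eq {p : ℕ} {l : Ptn} {k : ℕ} (h : k < l.height) :
    l.cutBd (k + 1) = min ((phi p l).bd k) (target p l (k + 1) + p) ∧
      target p l k =
        if (phi p l).bd k < target p l (k + 1) + p then target p l (k + 1)
        else (phi p l).bd k := by
  -- Row `k` ends a segment exactly when its new bead is at least `target p l (k + 1) + p`; in that
  -- case the right-hand quantity is the next bead and the new bead is the old target.
  rw [bd_phi h, target_succ h]
  have h1 := edgeLeft_le p l k
  have h2 : l.cutBd (k + 1) < l.cutBd k := by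
    rw [cutBd_of_lt h, cutBd]
    exact max_lt (l.bd_strictAnti (Nat.lt_succ_self k)) (lt_bd_of_lt_height h)
  have h3 : l.cutBd k ≤ target p l k + p := by
    simp only [target]
    omega
  split_ifs <;> omega

/-- The height and the edge length fix the target at the bottom; the edge is then put back row by
row, going up. -/
theorem eq_of_phi_eq {p : ℕ} (hp : 0 < p) {l m : Ptn} (hphi : phi p l = phi p m)
    (hh : l.height = m.height) (he : e p l = e p m) : l = m := by
  have hE := edgeLeft_height_eq hp he
  have hT : ∀ j, j ≤ l.height →
      target p l (l.height - j) = target p m (l.height - j) := by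
    intro j
    induction j with
    | zero =>
      intro _
      rw [Nat.sub_zero, target, target, hE, ← hh, cutBd_height, hh, cutBd_height]
    | succ j ih =>
      intro hj
      have h1 : l.height - (j + 1) < l.height := by omega
      have h2 := (cutBd_and_target_eq (p := p) h1).2
      have h3 := (cutBd_and_target_eq (p := p) (hh ▸ h1)).2
      have h4 : l.height - (j + 1) + 1 = l.height - j := by omega
      rw [← hh] at h3
      rw [h4] at h2 h3
      rw [h2, h3, ih (by omega), hphi]
  have hT' : ∀ k, k ≤ l.height → target p l k = target p m k := by
    intro k hk
    have := hT (l.height - k) (by omega)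
    rwa [Nat.sub_sub_self hk] at this
  refine ext_bd fun k => ?_
  rcases Nat.lt_or_ge k l.height with hk | hk
  · rw [← cutBd_of_lt hk, ← cutBd_of_lt (hh ▸ hk)]
    cases k with
    | zero =>
      have := hT' 0 (by omega)
      rw [target_zero, target_zero] at this
      omega
    | succ k =>
      rw [(cutBd_and_target_eq (p := p) (show k < l.height by omega)).1,
        (cutBd_and_target_eq (p := p) (show k < m.height by omega)).1, hphi, hT' _ (by omega)]
  · rw [bd_of_height_le hk, bd_of_height_le (hh ▸ hk)]

theorem symA_succ (p : ℕ) (l : Ptn) (j : ℕ) : symA p l (j + 1) = symA p (phi p l) j := by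
  simp [symA]

theorem symR_succ (p : ℕ) (l : Ptn) (j : ℕ) : symR p l (j + 1) = symR p (phi p l) j := by
  simp [symR]

theorem phi_part_zero_lt {p : ℕ} (hp : 0 < p) {l : Ptn} (h : 0 < l.part 0) :
    (phi p l).part 0 < l.part 0 := by
  have h1 := l.anti (Nat.le_succ 0)
  simp only [phi, edgeRow, edgeLeft, rimRow, Nat.succ_eq_add_one] at *
  split_ifs <;> omega

/-- Induction on the first part, which strictly decreases under `phi`. -/
theorem eq_of_symbol_eq {p : ℕ} (hp : 0 < p) {l m : Ptn} (hA : ∀ j, symA p l j = symA p m j)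
    (hR : ∀ j, symR p l j = symR p m j) : l = m := by
  induction hn : l.part 0 using Nat.strong_induction_on generalizing l m with
  | _ n ih =>
    have hh : l.height = m.height := hR 0
    rcases Nat.eq_zero_or_pos (l.part 0) with h0 | h0
    · have h1 : l.height = 0 := by
        have := (part_eq_zero_iff l 0).1 h0
        omega
      refine ext_bd fun k => ?_
      rw [bd_of_height_le (by omega), bd_of_height_le (by omega)]
    · refine eq_of_phi_eq hp ?_ hh (hA 0)
      refine ih _ (hn ▸ phi_part_zero_lt hp h0) (fun j => ?_) (fun j => ?_) rfl
      · rw [← symA_succ, ← symA_succ, hA]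
      · rw [← symR_succ, ← symR_succ, hR]

/-! ### Symbols related by the Mullineux involution -/

/-- The relation between the Mullineux symbols of a partition and of its Mullineux image. -/
def SymbolDual (p : ℕ) (l m : Ptn) : Prop :=
  ∀ j, symA p m j = symA p l j ∧
    symR p m j + symR p l j = symA p l j + if p ∣ symA p l j then 0 else 1

theorem SymbolDual.of_phi {p : ℕ} {l m : Ptn} (h : SymbolDual p (phi p l) (phi p m))
    (he : e p m = e p l)
    (hh : m.height + l.height = e p l + if p ∣ e p l then 0 else 1) : SymbolDual p l m := by
  intro j
  cases j with
  | zero => exact ⟨he, hh⟩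
  | succ j => simpa only [symA_succ, symR_succ] using h j

theorem phi_of_height_eq_zero {p : ℕ} {l : Ptn} (h : l.height = 0) : phi p l = l :=
  ext_bd fun _ => bd_phi_of_le (by omega)

theorem SymbolDual.of_height_eq_zero {p : ℕ} {l m : Ptn} (hl : l.height = 0)
    (hm : m.height = 0) : SymbolDual p l m := by
  have key : ∀ {n : Ptn}, n.height = 0 → ∀ j, (phi p)^[j] n = n := fun {n} hn j =>
    Function.iterate_fixed (phi_of_height_eq_zero hn) j
  intro j
  simp [symA, symR, key hl, key hm, e, hl, hm]

/-- The chosen image has the same symbol as `m`, hence equals `m`: it suffices to guess an image and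
verify it. -/
theorem mullineux_eq {p : ℕ} (hp : 0 < p) {l m : Ptn} (hm : m.IsRegular p)
    (h : SymbolDual p l m) : mullineux p l = m := by
  have hex : ∃ m, IsMullineuxImage p l m := ⟨m, hm, h⟩
  have hs := hex.choose_spec.2
  rw [mullineux, dif_pos hex]
  refine eq_of_symbol_eq hp (fun j => ?_) (fun j => ?_)
  · rw [(hs j).1, (h j).1]
  · have h1 := (hs j).2
    have h2 := (h j).2
    omega

/-! ### Bead sets and the effect of one or two segments on them -/

/-- `B` is the set of beads of an abacus of `l`. -/
def Rep (l : Ptn) (B : Set ℤ) : Prop := ∃ d : ℤ, ∀ n, n ∈ B ↔ ∃ k, n = l.bd k + d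

theorem eq_of_strictAnti {f g : ℕ → ℤ} (hf : StrictAnti f) (hg : StrictAnti g)
    (h : ∀ n, (∃ k, n = f k) ↔ ∃ k, n = g k) : f = g := by
  have h1 : StrictMono fun k => OrderDual.toDual (f k) := fun a b hab => hf hab
  have h2 : StrictMono fun k => OrderDual.toDual (g k) := fun a b hab => hg hab
  have h3 := (StrictMono.range_inj h1 h2).1 (by
    ext n
    constructor
    · rintro ⟨k, hk⟩
      obtain ⟨k', hk'⟩ := (h _).1 ⟨k, rfl⟩
      exact ⟨k', by rw [← hk]; exact congrArg OrderDual.toDual hk'.symm⟩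
    · rintro ⟨k, hk⟩
      obtain ⟨k', hk'⟩ := (h _).2 ⟨k, rfl⟩
      exact ⟨k', by rw [← hk]; exact congrArg OrderDual.toDual hk'.symm⟩)
  exact funext fun k => congrArg OrderDual.ofDual (congrFun h3 k)

theorem bd_add_strictAnti (l : Ptn) (d : ℤ) : StrictAnti fun k => l.bd k + d :=
  fun _ _ hab => add_lt_add_left (l.bd_strictAnti hab) d

section
variable {l : Ptn} {B : Set ℤ} {c d : ℤ}

theorem firstSpace_eq (hd : ∀ n, n ∈ B ↔ ∃ k, n = l.bd k + d) (hc : c ∉ B)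
    (hlt : ∀ n, n < c → n ∈ B) : c = 1 - l.height + d := by
  rcases lt_trichotomy c (1 - l.height + d) with h | h | h
  · refine absurd ((hd c).2 ⟨(d - c).toNat, ?_⟩) hc
    rw [bd_of_height_le (by omega)]
    omega
  · exact h
  · obtain ⟨k, hk⟩ := (hd _).1 (hlt _ h)
    rcases Nat.lt_or_ge k l.height with h1 | h1
    · have := lt_bd_of_lt_height h1
      omega
    · rw [bd_of_height_le h1] at hk
      omega

theorem Rep.height_eq (h : Rep l B) (hc : c ∉ B) (hlt : ∀ n, n < c → n ∈ B) {X : Finset ℤ}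
    (hX : ∀ n, n ∈ X ↔ n ∈ B ∧ c < n) : l.height = X.card := by
  obtain ⟨d, hd⟩ := h
  have hc' := firstSpace_eq hd hc hlt
  have : X = (Finset.range l.height).image fun k => l.bd k + d := by
    ext n
    rw [hX, hd, Finset.mem_image]
    constructor
    · rintro ⟨⟨k, hk⟩, hn⟩
      refine ⟨k, Finset.mem_range.2 ?_, hk.symm⟩
      by_contra hk'
      rw [bd_of_height_le (by omega)] at hk
      omega
    · rintro ⟨k, hk, rfl⟩
      have := lt_bd_of_lt_height (Finset.mem_range.1 hk)
      exact ⟨⟨k, rfl⟩, by omega⟩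
  rw [this, Finset.card_image_of_injective, Finset.card_range]
  intro a b hab
  exact l.bd_strictAnti.injective (by simpa using hab)

theorem bd_zero_add_eq (hd : ∀ n, n ∈ B ↔ ∃ k, n = l.bd k + d) {t : ℤ} (ht : t ∈ B)
    (hmax : ∀ n ∈ B, n ≤ t) : t = l.bd 0 + d := by
  obtain ⟨k, hk⟩ := (hd t).1 ht
  have h1 := hmax _ ((hd _).2 ⟨0, rfl⟩)
  have h2 := l.bd_strictAnti.antitone (Nat.zero_le k)
  omega

/-- While the beads stay above the target of row `s`, no new segment starts and the node counts
telescope. -/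
theorem target_eq_and_sum_edgeRow {p : ℕ} {s k : ℕ} (hsk : s ≤ k) (hk : k < l.height)
    (hgt : ∀ j, s < j → j ≤ k → target p l s < l.bd j) :
    target p l k = target p l s ∧
      ((∑ j ∈ Finset.range k, edgeRow p l j : ℕ) : ℤ) =
        (∑ j ∈ Finset.range s, edgeRow p l j : ℕ) + l.bd s - l.bd k := by
  induction k, hsk using Nat.le_induction with
  | base => exact ⟨rfl, by ring⟩
  | succ k hsk ih =>
    obtain ⟨h1, h2⟩ := ih (by omega) fun j hj hj' => hgt j hj (by omega)
    have h3 := hgt (k + 1) (by omega) le_rfl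
    have h4 : k < l.height := by omega
    refine ⟨?_, ?_⟩
    · rw [target_succ h4, cutBd_of_lt hk, h1, if_neg (by omega)]
    · rw [Finset.sum_range_succ, Nat.cast_add, h2, edgeRow_eq h4, cutBd_of_lt hk,
        cutBd_of_lt h4, h1, max_eq_right h3.le]
      ring

theorem exists_lt_height_of_lt (hd : ∀ n, n ∈ B ↔ ∃ k, n = l.bd k + d) (hc : c ∉ B)
    (hlt : ∀ n, n < c → n ∈ B) {t : ℤ} (ht : t ∈ B) (hct : c < t) :
    ∃ k, k < l.height ∧ t = l.bd k + d := by
  have hc' := firstSpace_eq hd hc hlt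
  obtain ⟨k, hk⟩ := (hd t).1 ht
  refine ⟨k, ?_, hk⟩
  by_contra hk'
  rw [bd_of_height_le (by omega)] at hk
  omega

/-- Removal of a `p`-edge which consists of one segment. -/
theorem Rep.phi_single {p : ℕ} (h : Rep l B) (hc : c ∉ B) (hlt : ∀ n, n < c → n ∈ B) {t : ℤ}
    (ht : t ∈ B) (hmax : ∀ n ∈ B, n ≤ t) (hct : c < t) (hgt : ∀ n ∈ B, c < n → t - p < n)
    {B₁ : Set ℤ} (hB₁ : ∀ n, n ∈ B₁ ↔ n = max (t - p) c ∨ n ∈ B ∧ n ≠ t) :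
    Rep (phi p l) B₁ ∧ (e p l : ℤ) = t - max (t - p) c := by
  obtain ⟨d, hd⟩ := h
  have hc' := firstSpace_eq hd hc hlt
  have ht' := bd_zero_add_eq hd ht hmax
  obtain ⟨k₀, hk₀, -⟩ := exists_lt_height_of_lt hd hc hlt ht hct
  have hT0 : target p l 0 = l.bd 0 - p := by rw [target_zero, cutBd_of_lt (by omega)]
  have hbig : ∀ j, j < l.height → target p l 0 < l.bd j := fun j hj => by
    have := hgt _ ((hd _).2 ⟨j, rfl⟩) (by have := lt_bd_of_lt_height hj; omega)
    omega
  have key : ∀ k, k < l.height → target p l k = l.bd 0 - p ∧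
      ((∑ j ∈ Finset.range k, edgeRow p l j : ℕ) : ℤ) = l.bd 0 - l.bd k := fun k hk => by
    have := target_eq_and_sum_edgeRow (p := p) (Nat.zero_le k) hk
      fun j _ hj => hbig j (by omega)
    rw [hT0] at this
    simpa using this
  have hphi : ∀ k, k + 1 < l.height → (phi p l).bd k = l.bd (k + 1) := fun k hk => by
    have := hbig _ hk
    rw [bd_phi (by omega), (key k (by omega)).1, cutBd_of_lt hk]
    omega
  -- The last nonzero row is followed by the first space `c`, the cut-off value; this is where the
  -- starting bead lands.
  have hlast : (phi p l).bd (l.height - 1) + d = max (t - p) c := by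
    rw [bd_phi (by omega), (key _ (by omega)).1, Nat.sub_add_cancel (by omega), cutBd_height]
    omega
  refine ⟨⟨d, fun n => ?_⟩, ?_⟩
  · rw [hB₁]
    constructor
    · rintro (rfl | ⟨h1, h2⟩)
      · exact ⟨_, hlast.symm⟩
      · obtain ⟨k, rfl⟩ := (hd n).1 h1
        rcases Nat.lt_or_ge k l.height with hk | hk
        · have hk0 : k ≠ 0 := by rintro rfl; exact h2 ht'.symm
          refine ⟨k - 1, ?_⟩
          rw [hphi _ (by omega), Nat.sub_add_cancel (by omega)]
        · exact ⟨k, by rw [bd_phi_of_le hk]⟩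
    · rintro ⟨k, rfl⟩
      rcases Nat.lt_or_ge k l.height with hk | hk
      · rcases Nat.lt_or_ge (k + 1) l.height with hk' | hk'
        · rw [hphi k hk']
          have := l.bd_strictAnti (Nat.succ_pos k)
          exact Or.inr ⟨(hd _).2 ⟨_, rfl⟩, by simp only [Nat.succ_eq_add_one] at this; omega⟩
        · left
          rw [← hlast]
          congr 2
          omega
      · rw [bd_phi_of_le hk]
        have := l.bd_strictAnti (show 0 < k by omega)
        exact Or.inr ⟨(hd _).2 ⟨_, rfl⟩, by omega⟩
  · have h1 : l.height - 1 < l.height := by omega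
    have h2 := key _ h1
    have h3 : l.height - 1 + 1 = l.height := by omega
    unfold e
    rw [← h3, Finset.sum_range_succ, Nat.cast_add, h2.2, edgeRow_eq h1, h2.1, h3,
      cutBd_height, cutBd_of_lt h1]
    omega

/-- Removal of a `p`-edge which consists of two segments. -/
theorem Rep.phi_double {p : ℕ} (h : Rep l B) (hc : c ∉ B) (hlt : ∀ n, n < c → n ∈ B) {t b : ℤ}
    (ht : t ∈ B) (hmax : ∀ n ∈ B, n ≤ t) (hb : b ∈ B) (hcb : c < b) (hbt : b ≤ t - p)
    (hp : 0 < p) (hbmax : ∀ n ∈ B, n ≤ t - p → n ≤ b) (hgt : ∀ n ∈ B, c < n → b - p < n)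
    {B₁ : Set ℤ}
    (hB₁ : ∀ n, n ∈ B₁ ↔ n = t - p ∨ n = max (b - p) c ∨ n ∈ B ∧ n ≠ t ∧ n ≠ b) :
    Rep (phi p l) B₁ ∧ (e p l : ℤ) = p + (b - max (b - p) c) := by
  obtain ⟨d, hd⟩ := h
  have hc' := firstSpace_eq hd hc hlt
  have ht' := bd_zero_add_eq hd ht hmax
  obtain ⟨s, hs, hs'⟩ := exists_lt_height_of_lt hd hc hlt hb hcb
  have hanti : ∀ {i j : ℕ}, i < j → l.bd j < l.bd i := fun h => l.bd_strictAnti h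
  have hs0 : 0 < s := by
    rcases Nat.eq_zero_or_pos s with h0 | h0
    · rw [h0] at hs'
      omega
    · exact h0
  have hT0 : target p l 0 = l.bd 0 - p := by rw [target_zero, cutBd_of_lt (by omega)]
  have hbig1 : ∀ j, j < s → target p l 0 < l.bd j := fun j hj => by
    by_contra hj'
    have := hbmax _ ((hd _).2 ⟨j, rfl⟩) (by omega)
    have := hanti hj
    omega
  have key1 : ∀ k, k < s → target p l k = l.bd 0 - p ∧
      ((∑ j ∈ Finset.range k, edgeRow p l j : ℕ) : ℤ) = l.bd 0 - l.bd k := fun k hk => by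
    have := target_eq_and_sum_edgeRow (p := p) (Nat.zero_le k) (by omega : k < l.height)
      fun j _ hj => hbig1 j (by omega)
    rw [hT0] at this
    simpa using this
  have hs1 : s - 1 < l.height := by omega
  have hs2 : s - 1 + 1 = s := by omega
  -- Row `s` carries `b`, the first bead not above `t - p`, so the first segment ends in row `s - 1`
  -- with exactly `p` nodes.
  have hTs : target p l s = l.bd s - p := by
    rw [← hs2, target_succ hs1, (key1 _ (by omega)).1, hs2, cutBd_of_lt hs, if_pos (by omega)]
  have hsum : ((∑ j ∈ Finset.range s, edgeRow p l j : ℕ) : ℤ) = p := by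
    rw [← hs2, Finset.sum_range_succ, Nat.cast_add, (key1 _ (by omega)).2, edgeRow_eq hs1,
      (key1 _ (by omega)).1, hs2, cutBd_of_lt hs, cutBd_of_lt hs1]
    omega
  have hbig2 : ∀ j, j < l.height → target p l s < l.bd j := fun j hj => by
    have := hgt _ ((hd _).2 ⟨j, rfl⟩) (by have := lt_bd_of_lt_height hj; omega)
    omega
  have key2 : ∀ k, s ≤ k → k < l.height → target p l k = l.bd s - p ∧
      ((∑ j ∈ Finset.range k, edgeRow p l j : ℕ) : ℤ) = p + l.bd s - l.bd k := fun k hk hk' => by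
    have := target_eq_and_sum_edgeRow (p := p) hk hk' fun j _ hj => hbig2 j (by omega)
    rw [hTs, hsum] at this
    exact this
  have hphi : ∀ k, k + 1 < l.height → k + 1 ≠ s → (phi p l).bd k = l.bd (k + 1) :=
    fun k hk hks => by
    rw [bd_phi (by omega), cutBd_of_lt hk]
    rcases Nat.lt_or_ge k s with h1 | h1
    · have := hbig1 (k + 1) (by omega)
      rw [(key1 k h1).1]
      omega
    · have := hbig2 (k + 1) (by omega)
      rw [(key2 k h1 (by omega)).1]
      omega
  have hmid : (phi p l).bd (s - 1) + d = t - p := by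
    rw [bd_phi hs1, (key1 _ (by omega)).1, hs2, cutBd_of_lt hs]
    omega
  have hlast : (phi p l).bd (l.height - 1) + d = max (b - p) c := by
    rw [bd_phi (by omega), (key2 _ (by omega) (by omega)).1, Nat.sub_add_cancel (by omega),
      cutBd_height]
    omega
  refine ⟨⟨d, fun n => ?_⟩, ?_⟩
  · rw [hB₁]
    constructor
    · rintro (rfl | rfl | ⟨h1, h2, h3⟩)
      · exact ⟨_, hmid.symm⟩
      · exact ⟨_, hlast.symm⟩
      · obtain ⟨k, rfl⟩ := (hd n).1 h1
        rcases Nat.lt_or_ge k l.height with hk | hk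
        · have hk0 : k ≠ 0 := by rintro rfl; exact h2 ht'.symm
          have hks : k ≠ s := by rintro rfl; exact h3 hs'.symm
          refine ⟨k - 1, ?_⟩
          rw [hphi _ (by omega) (by omega), Nat.sub_add_cancel (by omega)]
        · exact ⟨k, by rw [bd_phi_of_le hk]⟩
    · rintro ⟨k, rfl⟩
      rcases Nat.lt_or_ge k l.height with hk | hk
      · rcases Nat.lt_or_ge (k + 1) l.height with hk' | hk'
        · by_cases hks : k + 1 = s
          · left
            rw [← hmid, ← hks]
            rfl
          · rw [hphi k hk' hks]
            refine Or.inr (Or.inr ⟨(hd _).2 ⟨_, rfl⟩, ?_, ?_⟩)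
            · have := hanti (Nat.succ_pos k)
              simp only [Nat.succ_eq_add_one] at this
              omega
            · intro h
              exact hks (l.bd_strictAnti.injective (by omega))
        · right
          left
          rw [← hlast]
          congr 2
          omega
      · rw [bd_phi_of_le hk]
        have h1 := hanti (show 0 < k by omega)
        have h2 := hanti (show s < k by omega)
        exact Or.inr (Or.inr ⟨(hd _).2 ⟨_, rfl⟩, by omega, by omega⟩)
  · have h1 : l.height - 1 < l.height := by omega
    have h2 := key2 _ (by omega) h1
    have h3 : l.height - 1 + 1 = l.height := by omega
    unfold e
    rw [← h3, Finset.sum_range_succ, Nat.cast_add, h2.2, edgeRow_eq h1, h2.1, h3,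
      cutBd_height, cutBd_of_lt h1]
    omega

end

/-- Every partition represented by the set of beads `B` has a `p`-edge with `A` nodes and height
`N`, and removing the `p`-edge leads to a partition represented by `B₁`. -/
def EdgeStep (p : ℕ) (B B₁ : Set ℤ) (A N : ℕ) : Prop :=
  ∀ l, Rep l B → Rep (phi p l) B₁ ∧ e p l = A ∧ l.height = N

/-- Partitions represented by `B` and `B'` have Mullineux symbols related by the Mullineux
involution. -/
def BeadDual (p : ℕ) (B B' : Set ℤ) : Prop :=
  ∀ l m, Rep l B → Rep m B' → SymbolDual p l m

theorem BeadDual.of_step {p : ℕ} {B B₁ B' B₁' : Set ℤ} {A N N' : ℕ} (h : EdgeStep p B B₁ A N)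
    (h' : EdgeStep p B' B₁' A N') (hN : N' + N = A + if p ∣ A then 0 else 1)
    (hd : BeadDual p B₁ B₁') : BeadDual p B B' := by
  intro l m hl hm
  obtain ⟨h1, h2, h3⟩ := h l hl
  obtain ⟨h4, h5, h6⟩ := h' m hm
  refine (hd _ _ h1 h4).of_phi (h5.trans h2.symm) ?_
  rw [h2, h3, h6, hN]

/-! ### Windows on runners and their `p`-edges -/

/-- `f` enumerates, in increasing order, a union of `s` residue classes modulo `p`. -/
structure IsRunner (p s : ℕ) (f : ℤ → ℤ) : Prop where
  mono : StrictMono f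
  shift : ∀ n, f (n + s) = f n + p

/-- The window of `s` consecutive values of `f` starting at the index `y`. -/
noncomputable def win (f : ℤ → ℤ) (y : ℤ) (s : ℕ) : Finset ℤ := (Finset.Ico y (y + s)).image f

theorem mem_win {f : ℤ → ℤ} {y : ℤ} {s : ℕ} {n : ℤ} :
    n ∈ win f y s ↔ ∃ k, (y ≤ k ∧ k < y + s) ∧ f k = n := by
  simp [win]

theorem IsRunner.card_win {p s : ℕ} {f : ℤ → ℤ} (hf : IsRunner p s f) (y : ℤ) (r : ℕ) :
    (win f y r).card = r := by
  rw [win, Finset.card_image_of_injective _ hf.mono.injective]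
  simp

theorem IsRunner.le_of_mem {p s : ℕ} {f : ℤ → ℤ} (hf : IsRunner p s f) {y : ℤ} {r : ℕ} {n : ℤ}
    (hn : n ∈ win f y r) : f y ≤ n := by
  obtain ⟨k, hk, rfl⟩ := mem_win.1 hn
  exact hf.mono.monotone hk.1

theorem IsRunner.lt_of_mem {p s : ℕ} {f : ℤ → ℤ} (hf : IsRunner p s f) {y : ℤ} {r : ℕ} {n : ℤ}
    (hn : n ∈ win f (y + 1) r) : f y < n :=
  (hf.mono (by omega)).trans_le (hf.le_of_mem hn)

theorem IsRunner.le_of_mem_succ {p s : ℕ} {f : ℤ → ℤ} (hf : IsRunner p s f) {y : ℤ} {n : ℤ}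
    (hn : n ∈ win f (y + 1) s) : n ≤ f y + p := by
  obtain ⟨k, hk, rfl⟩ := mem_win.1 hn
  rw [← hf.shift]
  exact hf.mono.monotone (by omega)

theorem IsRunner.top_mem {p s : ℕ} {f : ℤ → ℤ} (hf : IsRunner p s f) (hs : 0 < s) (y : ℤ) :
    f y + p ∈ win f (y + 1) s :=
  mem_win.2 ⟨y + s, by omega, hf.shift y⟩

/-- Periodicity makes the top of the upper window equal to `f y + p`, so sliding down by one index
is a single bead move by `p`. -/
theorem IsRunner.mem_win_iff {p s : ℕ} {f : ℤ → ℤ} (hf : IsRunner p s f) (hs : 0 < s) {y n : ℤ} :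
    n ∈ win f y s ↔ n = f y ∨ n ∈ win f (y + 1) s ∧ n ≠ f y + p := by
  rw [mem_win, mem_win, ← hf.shift]
  constructor
  · rintro ⟨k, hk, rfl⟩
    by_cases hky : k = y
    · exact Or.inl (by rw [hky])
    · exact Or.inr ⟨⟨k, by omega, rfl⟩, fun h => by
        have := hf.mono.injective h
        omega⟩
  · rintro (rfl | ⟨⟨k, hk, rfl⟩, h2⟩)
    · exact ⟨y, by omega, rfl⟩
    · have : k ≠ y + s := fun h => h2 (by rw [h])
      exact ⟨k, by omega, rfl⟩

/-- The top bead drops to `f y`, below all other window beads and not below `c`: one full segment.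
-/
theorem edgeStep_window {p s : ℕ} {f : ℤ → ℤ} (hf : IsRunner p s f) (hs : 0 < s) (hp : 0 < p)
    {c y : ℤ} (hc : c ≤ f y) :
    EdgeStep p (Set.Iio c ∪ win f (y + 1) s) (Set.Iio c ∪ win f y s) p s := by
  intro l hl
  have hlow : ∀ n ∈ win f (y + 1) s, f y < n := fun n hn => hf.lt_of_mem hn
  have hup : ∀ n ∈ win f (y + 1) s, n ≤ f y + p := fun n hn => hf.le_of_mem_succ hn
  have htop := hf.top_mem hs y
  have hmem : ∀ n, n ∈ (Set.Iio c ∪ win f (y + 1) s : Set ℤ) ↔ n < c ∨ n ∈ win f (y + 1) s := by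
    simp
  have hc1 : c ∉ (Set.Iio c ∪ win f (y + 1) s : Set ℤ) := by
    rw [hmem]
    rintro (h | h)
    · omega
    · have := hlow _ h
      omega
  have hlt : ∀ n < c, n ∈ (Set.Iio c ∪ win f (y + 1) s : Set ℤ) := fun n hn => Or.inl hn
  obtain ⟨h1, h2⟩ := hl.phi_single (p := p) (t := f y + p) hc1 hlt (Or.inr htop)
    (fun n hn => by
      rcases (hmem n).1 hn with h | h
      · omega
      · exact hup n h) (by omega)
    (fun n hn hn' => by
      rcases (hmem n).1 hn with h | h
      · omega
      · have := hlow n h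
        omega) (B₁ := Set.Iio c ∪ win f y s) (fun n => by
      rw [hmem, Set.mem_union, Finset.mem_coe, hf.mem_win_iff hs, Set.mem_Iio,
        show max (f y + p - p) c = f y by omega]
      constructor
      · rintro (h | h | h)
        · exact Or.inr ⟨Or.inl h, by omega⟩
        · exact Or.inl h
        · exact Or.inr ⟨Or.inr h.1, h.2⟩
      · rintro (h | ⟨h | h, h'⟩)
        · exact Or.inr (Or.inl h)
        · exact Or.inl h
        · exact Or.inr (Or.inr ⟨h, h'⟩))
  refine ⟨h1, by omega, ?_⟩
  rw [hl.height_eq hc1 hlt (X := win f (y + 1) s), hf.card_win]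
  intro n
  rw [hmem]
  constructor
  · intro h
    have := hlow n h
    exact ⟨Or.inr h, by omega⟩
  · rintro ⟨h | h, h'⟩
    · omega
    · exact h

/-- The window loses a full segment. The second segment starts at the top `w - 1` of the block,
which lies at most `p` above the first space `j` and therefore fills it. -/
theorem edgeStep_block_window {p s : ℕ} {f : ℤ → ℤ} (hf : IsRunner p s f) (hs : 0 < s)
    (hp : 0 < p) {j u w y : ℤ} (hju : j < u) (huw : u < w) (hwp : w ≤ j + p + 1)
    (hwy : w - 1 ≤ f y) :
    EdgeStep p (Set.Iio j ∪ Set.Ico u w ∪ win f (y + 1) s)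
      (Set.Iio (j + 1) ∪ Set.Ico u (w - 1) ∪ win f y s) (p + (w - 1 - j).toNat)
      ((w - u).toNat + s) := by
  intro l hl
  have hlow : ∀ n ∈ win f (y + 1) s, f y < n := fun n hn => hf.lt_of_mem hn
  have hup : ∀ n ∈ win f (y + 1) s, n ≤ f y + p := fun n hn => hf.le_of_mem_succ hn
  have htop := hf.top_mem hs y
  have hmem : ∀ n, n ∈ (Set.Iio j ∪ Set.Ico u w ∪ win f (y + 1) s : Set ℤ) ↔
      n < j ∨ (u ≤ n ∧ n < w) ∨ n ∈ win f (y + 1) s := by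
    simp [or_assoc]
  have hc1 : j ∉ (Set.Iio j ∪ Set.Ico u w ∪ win f (y + 1) s : Set ℤ) := by
    rw [hmem]
    rintro (h | h | h)
    · omega
    · omega
    · have := hlow _ h
      omega
  have hlt : ∀ n < j, n ∈ (Set.Iio j ∪ Set.Ico u w ∪ win f (y + 1) s : Set ℤ) :=
    fun n hn => Or.inl (Or.inl hn)
  obtain ⟨h1, h2⟩ := hl.phi_double (p := p) (t := f y + p) (b := w - 1) hc1 hlt (Or.inr htop)
    (fun n hn => by
      rcases (hmem n).1 hn with h | h | h
      · omega
      · omega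
      · exact hup n h) ((hmem _).2 (Or.inr (Or.inl (by omega)))) (by omega) (by omega) hp
    (fun n hn hn' => by
      rcases (hmem n).1 hn with h | h | h
      · omega
      · omega
      · have := hlow n h
        omega)
    (fun n hn hn' => by
      rcases (hmem n).1 hn with h | h | h
      · omega
      · omega
      · have := hlow n h
        omega)
    (B₁ := Set.Iio (j + 1) ∪ Set.Ico u (w - 1) ∪ win f y s) (fun n => by
      rw [hmem, Set.mem_union, Set.mem_union, Finset.mem_coe, hf.mem_win_iff hs, Set.mem_Iio,
        Set.mem_Ico, show f y + p - p = f y by omega, show max (w - 1 - p) j = j by omega]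
      constructor
      · rintro ((h | h) | h | h)
        · by_cases hn : n = j
          · exact Or.inr (Or.inl hn)
          · exact Or.inr (Or.inr ⟨Or.inl (by omega), by omega, by omega⟩)
        · exact Or.inr (Or.inr ⟨Or.inr (Or.inl (by omega)), by omega, by omega⟩)
        · exact Or.inl h
        · have := hlow n h.1
          exact Or.inr (Or.inr ⟨Or.inr (Or.inr h.1), h.2, by omega⟩)
      · rintro (h | h | ⟨h | h | h, h', h''⟩)
        · exact Or.inr (Or.inl h)
        · exact Or.inl (Or.inl (by omega))
        · exact Or.inl (Or.inl (by omega))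
        · exact Or.inl (Or.inr (by omega))
        · exact Or.inr (Or.inr ⟨h, h'⟩))
  refine ⟨h1, by omega, ?_⟩
  rw [hl.height_eq hc1 hlt (X := Finset.Ico u w ∪ win f (y + 1) s), Finset.card_union_of_disjoint,
    hf.card_win, Int.card_Ico]
  · rw [Finset.disjoint_left]
    intro n h1 h2
    have h3 := hlow n h2
    have h4 := Finset.mem_Ico.1 h1
    omega
  · intro n
    rw [hmem, Finset.mem_union, Finset.mem_Ico]
    constructor
    · rintro (h | h)
      · exact ⟨Or.inr (Or.inl h), by omega⟩
      · have := hlow n h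
        exact ⟨Or.inr (Or.inr h), by omega⟩
    · rintro ⟨h | h | h, h'⟩
      · omega
      · exact Or.inl h
      · exact Or.inr h

/-- By `hy` the lower window lies at or below the landing place of the upper top bead, so each
window loses its own full segment. -/
theorem edgeStep_two_windows {p s₁ s₂ : ℕ} {f₁ f₂ : ℤ → ℤ} (hf₁ : IsRunner p s₁ f₁)
    (hf₂ : IsRunner p s₂ f₂) (hs₁ : 0 < s₁) (hs₂ : 0 < s₂) (hp : 0 < p) {c y₁ y₂ : ℤ}
    (hc : c ≤ f₁ y₁) (hy : f₁ y₁ + p ≤ f₂ y₂) :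
    EdgeStep p (Set.Iio c ∪ win f₁ (y₁ + 1) s₁ ∪ win f₂ (y₂ + 1) s₂)
      (Set.Iio c ∪ win f₁ y₁ s₁ ∪ win f₂ y₂ s₂) (p + p) (s₁ + s₂) := by
  intro l hl
  have hlow₁ : ∀ n ∈ win f₁ (y₁ + 1) s₁, f₁ y₁ < n := fun n hn => hf₁.lt_of_mem hn
  have hup₁ : ∀ n ∈ win f₁ (y₁ + 1) s₁, n ≤ f₁ y₁ + p := fun n hn => hf₁.le_of_mem_succ hn
  have htop₁ := hf₁.top_mem hs₁ y₁
  have hlow₂ : ∀ n ∈ win f₂ (y₂ + 1) s₂, f₂ y₂ < n := fun n hn => hf₂.lt_of_mem hn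
  have hup₂ : ∀ n ∈ win f₂ (y₂ + 1) s₂, n ≤ f₂ y₂ + p := fun n hn => hf₂.le_of_mem_succ hn
  have htop₂ := hf₂.top_mem hs₂ y₂
  have hmem : ∀ n, n ∈ (Set.Iio c ∪ win f₁ (y₁ + 1) s₁ ∪ win f₂ (y₂ + 1) s₂ : Set ℤ) ↔
      n < c ∨ n ∈ win f₁ (y₁ + 1) s₁ ∨ n ∈ win f₂ (y₂ + 1) s₂ := by
    simp [or_assoc]
  have hc1 : c ∉ (Set.Iio c ∪ win f₁ (y₁ + 1) s₁ ∪ win f₂ (y₂ + 1) s₂ : Set ℤ) := by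
    rw [hmem]
    rintro (h | h | h)
    · omega
    · have := hlow₁ _ h
      omega
    · have := hlow₂ _ h
      omega
  have hlt : ∀ n < c, n ∈ (Set.Iio c ∪ win f₁ (y₁ + 1) s₁ ∪ win f₂ (y₂ + 1) s₂ : Set ℤ) :=
    fun n hn => Or.inl (Or.inl hn)
  obtain ⟨h1, h2⟩ := hl.phi_double (p := p) (t := f₂ y₂ + p) (b := f₁ y₁ + p) hc1 hlt
    (Or.inr htop₂)
    (fun n hn => by
      rcases (hmem n).1 hn with h | h | h
      · omega
      · have := hup₁ n h
        omega
      · exact hup₂ n h) (Or.inl (Or.inr htop₁)) (by omega) (by omega) hp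
    (fun n hn hn' => by
      rcases (hmem n).1 hn with h | h | h
      · omega
      · exact hup₁ n h
      · have := hlow₂ n h
        omega)
    (fun n hn hn' => by
      rcases (hmem n).1 hn with h | h | h
      · omega
      · have := hlow₁ n h
        omega
      · have := hlow₂ n h
        omega)
    (B₁ := Set.Iio c ∪ win f₁ y₁ s₁ ∪ win f₂ y₂ s₂) (fun n => by
      rw [hmem, Set.mem_union, Set.mem_union, Finset.mem_coe, Finset.mem_coe,
        hf₁.mem_win_iff hs₁, hf₂.mem_win_iff hs₂, Set.mem_Iio, show f₂ y₂ + p - p = f₂ y₂ by omega,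
        show max (f₁ y₁ + p - p) c = f₁ y₁ by omega]
      constructor
      · rintro ((h | h | h) | h | h)
        · exact Or.inr (Or.inr ⟨Or.inl h, by omega, by omega⟩)
        · exact Or.inr (Or.inl h)
        · have := hup₁ n h.1
          exact Or.inr (Or.inr ⟨Or.inr (Or.inl h.1), by omega, h.2⟩)
        · exact Or.inl h
        · have := hlow₂ n h.1
          exact Or.inr (Or.inr ⟨Or.inr (Or.inr h.1), h.2, by omega⟩)
      · rintro (h | h | ⟨h | h | h, h', h''⟩)
        · exact Or.inr (Or.inl h)
        · exact Or.inl (Or.inr (Or.inl h))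
        · exact Or.inl (Or.inl h)
        · exact Or.inl (Or.inr (Or.inr ⟨h, h''⟩))
        · exact Or.inr (Or.inr ⟨h, h'⟩))
  refine ⟨h1, by omega, ?_⟩
  rw [hl.height_eq hc1 hlt (X := win f₁ (y₁ + 1) s₁ ∪ win f₂ (y₂ + 1) s₂),
    Finset.card_union_of_disjoint, hf₁.card_win, hf₂.card_win]
  · rw [Finset.disjoint_left]
    intro n h1 h2
    have h3 := hlow₂ n h2
    have h4 := hup₁ n h1
    omega
  · intro n
    rw [hmem, Finset.mem_union]
    constructor
    · rintro (h | h)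
      · have := hlow₁ n h
        exact ⟨Or.inr (Or.inl h), by omega⟩
      · have := hlow₂ n h
        exact ⟨Or.inr (Or.inr h), by omega⟩
    · rintro ⟨h | h, h'⟩
      · omega
      · exact h

/-! ### Small hooks: the Mullineux involution is conjugation -/

-- With `t - c < p` the whole rim is one segment, and the top bead fills the first space.
open Classical in
theorem edgeStep_hook {p : ℕ} {B : Set ℤ} {c t : ℤ} (hc : c ∉ B) (hlt : ∀ n < c, n ∈ B)
    (ht : t ∈ B) (hmax : ∀ n ∈ B, n ≤ t) (hct : c < t) (hp : t - c < p) :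
    EdgeStep p B (insert c (B \ {t})) (t - c).toNat
      ((Finset.Icc c t).filter (· ∈ B)).card := by
  intro l hl
  obtain ⟨h1, h2⟩ := hl.phi_single (p := p) hc hlt ht hmax hct (fun n hn hn' => by omega)
    (B₁ := insert c (B \ {t})) (fun n => by
      rw [show max (t - p) c = c by omega]
      simp)
  refine ⟨h1, by omega, hl.height_eq hc hlt fun n => ?_⟩
  rw [Finset.mem_filter, Finset.mem_Icc]
  constructor
  · rintro ⟨h3, h4⟩
    have : n ≠ c := by rintro rfl; exact hc h4
    exact ⟨h4, by omega⟩
  · rintro ⟨h3, h4⟩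
    exact ⟨⟨h4.le, hmax n h3⟩, h3⟩

theorem Rep.height_eq_zero {l : Ptn} {c : ℤ} (h : Rep l (Set.Iio c)) : l.height = 0 := by
  rw [h.height_eq (c := c) (X := ∅) (by simp) (by simp)]
  · rfl
  · intro n
    simp only [Finset.notMem_empty, Set.mem_Iio, false_iff]
    omega

theorem beadDual_Iio {p : ℕ} (c c' : ℤ) : BeadDual p (Set.Iio c) (Set.Iio c') :=
  fun _ _ hl hm => SymbolDual.of_height_eq_zero hl.height_eq_zero hm.height_eq_zero

/-- Reflecting the complement is conjugation. Each edge is the whole rim, with `t - c < p` nodes;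
the two heights count the beads and the spaces of `[c, t]`, hence add up to `t - c + 1`. -/
theorem beadDual_reflect {p : ℕ} {B B' : Set ℤ} {c t κ : ℤ} (hlt : ∀ n < c, n ∈ B)
    (hmax : ∀ n ∈ B, n ≤ t) (hp : t - c < p) (hB' : ∀ n, n ∈ B' ↔ κ - n ∉ B) :
    BeadDual p B B' := by
  classical
  induction hN : (t + 1 - c).toNat using Nat.strong_induction_on generalizing c t B B' with
  | _ N ih =>
    by_cases htc : t < c
    · have h1 : B = Set.Iio c := by
        ext n
        refine ⟨fun h => ?_, fun h => hlt n h⟩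
        have := hmax n h
        simp only [Set.mem_Iio]
        omega
      have h2 : B' = Set.Iio (κ - c + 1) := by
        ext n
        rw [hB', h1]
        simp only [Set.mem_Iio]
        omega
      rw [h1, h2]
      exact beadDual_Iio _ _
    -- The bounds `c`, `t` are tightened until `c` is a space and `t` a bead; only then is an edge
    -- removed.
    by_cases hc : c ∈ B
    · refine ih _ ?_ (c := c + 1) (t := t) (fun n hn => ?_) hmax (by omega) hB' rfl
      · omega
      · rcases eq_or_ne n c with rfl | h
        · exact hc
        · exact hlt n (by omega)
    by_cases ht : t ∈ B
    swap
    · refine ih _ ?_ (c := c) (t := t - 1) hlt (fun n hn => ?_) (by omega) hB' rfl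
      · omega
      · have := hmax n hn
        have : n ≠ t := by rintro rfl; exact ht hn
        omega
    have hct : c < t := by
      have : t ≠ c := by rintro rfl; exact hc ht
      omega
    have hs := edgeStep_hook hc hlt ht hmax hct hp
    have hs' := edgeStep_hook (p := p) (B := B') (c := κ - t) (t := κ - c)
      (by rw [hB']; simpa using ht)
      (fun n hn => by
        rw [hB']
        intro h
        have := hmax _ h
        omega) (by rw [hB']; simpa using hc)
      (fun n hn => by
        rw [hB'] at hn
        by_contra h
        exact hn (hlt _ (by omega))) (by omega) (by omega)
    rw [show κ - c - (κ - t) = t - c by ring] at hs'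
    refine BeadDual.of_step hs hs' ?_ ?_
    · have h1 : ((Finset.Icc (κ - t) (κ - c)).filter (· ∈ B')).card =
          ((Finset.Icc c t).filter (· ∉ B)).card := by
        refine Finset.card_bij (fun n _ => κ - n) ?_ ?_ ?_
        · intro n hn
          rw [Finset.mem_filter, Finset.mem_Icc] at *
          exact ⟨by omega, (hB' n).1 hn.2⟩
        · intro a _ b _ h
          omega
        · intro n hn
          rw [Finset.mem_filter, Finset.mem_Icc] at hn
          refine ⟨κ - n, ?_, by ring⟩
          rw [Finset.mem_filter, Finset.mem_Icc, hB', sub_sub_cancel]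
          exact ⟨by omega, hn.2⟩
      have h2 := Finset.card_filter_add_card_filter_not (s := Finset.Icc c t) (· ∈ B)
      rw [Int.card_Icc] at h2
      have h3 : ¬ p ∣ (t - c).toNat := fun h => by
        have := Nat.le_of_dvd (by omega) h
        omega
      rw [h1, if_neg h3]
      omega
    · refine ih _ ?_ (c := c + 1) (t := t - 1) (fun n hn => ?_) (fun n hn => ?_) (by omega)
        (fun n => ?_) rfl
      · omega
      · rcases eq_or_ne n c with rfl | h
        · exact Or.inl rfl
        · exact Or.inr ⟨hlt n (by omega), by simp; omega⟩
      · rcases hn with h | ⟨h, h'⟩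
        · omega
        · have := hmax n h
          simp only [Set.mem_singleton_iff] at h'
          omega
      · simp only [Set.mem_insert_iff, Set.mem_sdiff, Set.mem_singleton_iff, hB']
        have e1 : κ - n = t ↔ n = κ - t := by omega
        have e2 : κ - n = c ↔ n = κ - c := by omega
        rw [e1, e2]
        by_cases h1 : n = κ - t
        · subst h1
          have : κ - t ≠ κ - c := by omega
          simp [this]
        · by_cases h2 : n = κ - c
          · simp [h2]
            omega
          · simp [h1, h2]

/-! ### Families of bead sets -/

/-- Each slide costs `p` nodes on both sides, and the heights `s`, `s'` add up to `p`, with `ε = 0`.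
At index `α` conjugation takes over. -/
theorem beadDual_windows {p s s' : ℕ} {f g : ℤ → ℤ} (hf : IsRunner p s f) (hg : IsRunner p s' g)
    (hs : 0 < s) (hs' : 0 < s') (hss : s + s' = p) {c c' α β κ : ℤ} (hc : c ≤ f α)
    (hfc : f (α - 1) < c) (hc' : c' ≤ g β)
    (h0 : ∀ n, n ∈ (Set.Iio c' ∪ win g β s' : Set ℤ) ↔ κ - n ∉ (Set.Iio c ∪ win f α s : Set ℤ))
    (n : ℕ) : BeadDual p (Set.Iio c ∪ win f (α + n) s) (Set.Iio c' ∪ win g (β + n) s') := by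
  induction n with
  | zero =>
    simp only [Nat.cast_zero, add_zero]
    -- The top of the initial window is `f (α - 1) + p`, which is less than `c + p` by `hfc`.
    refine beadDual_reflect (c := c) (t := c + p - 1) (fun n hn => Or.inl hn) ?_ (by omega) h0
    rintro n (hn | hn)
    · have : n < c := hn
      omega
    · rw [show α = α - 1 + 1 by ring] at hn
      have := hf.le_of_mem_succ hn
      omega
  | succ n ih =>
    have h1 : c ≤ f (α + n) := hc.trans (hf.mono.monotone (by omega))
    have h2 : c' ≤ g (β + n) := hc'.trans (hg.mono.monotone (by omega))
    have h3 := edgeStep_window hf hs (by omega) h1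
    have h4 := edgeStep_window hg hs' (by omega) h2
    rw [add_assoc] at h3 h4
    push_cast
    exact BeadDual.of_step h3 h4 (by rw [if_pos dvd_rfl]; omega) ih

/-- Both edges have `p + (w - 1 - j)` nodes, not a multiple of `p`; `hcard` says that the heights
add up to one more. It survives each step since `w + j` does not change. -/
theorem beadDual_block_windows {p s s' : ℕ} {f g : ℤ → ℤ} (hf : IsRunner p s f)
    (hg : IsRunner p s' g) (hs : 0 < s) (hs' : 0 < s') {u u' : ℤ} (k : ℕ) {j w y y' : ℤ}
    (hju : j + k ≤ u) (hju' : j + k ≤ u') (huw : u + k ≤ w) (huw' : u' + k ≤ w)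
    (hwp : w ≤ j + p) (hwf : w ≤ f (y - k) + 1) (hwg : w ≤ g (y' - k) + 1)
    (hcard : w + s + s' + j = p + u + u')
    (h : BeadDual p (Set.Iio (j + k) ∪ Set.Ico u (w - k) ∪ win f (y - k) s)
      (Set.Iio (j + k) ∪ Set.Ico u' (w - k) ∪ win g (y' - k) s')) :
    BeadDual p (Set.Iio j ∪ Set.Ico u w ∪ win f y s) (Set.Iio j ∪ Set.Ico u' w ∪ win g y' s') := by
  induction k generalizing j w y y' with
  | zero => simpa using h
  | succ k ih =>
    push_cast at *
    have h1 : w - 1 ≤ f (y - 1) := by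
      have := hf.mono.monotone (show y - (k + 1) ≤ y - 1 by omega)
      omega
    have h2 : w - 1 ≤ g (y' - 1) := by
      have := hg.mono.monotone (show y' - (k + 1) ≤ y' - 1 by omega)
      omega
    have h3 := edgeStep_block_window (p := p) (j := j) (u := u) (w := w) hf hs (by omega)
      (by omega) (by omega) (by omega) h1
    have h4 := edgeStep_block_window (p := p) (j := j) (u := u') (w := w) hg hs' (by omega)
      (by omega) (by omega) (by omega) h2
    rw [sub_add_cancel] at h3 h4
    have h5 : ¬ p ∣ p + (w - 1 - j).toNat := fun h => by
      have := Nat.le_of_dvd (by omega) ((Nat.dvd_add_right dvd_rfl).1 h)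
      omega
    refine BeadDual.of_step h3 h4 (by rw [if_neg h5]; omega) ?_
    have e1 : ∀ z : ℤ, z - 1 - k = z - (k + 1) := fun z => by ring
    refine ih (by omega) (by omega) (by omega) (by omega) (by omega) ?_ ?_ (by omega) ?_
    · rw [e1]; omega
    · rw [e1]; omega
    · rw [e1, e1, e1, show j + 1 + k = j + (k + 1) by ring]
      exact h

/-- Every edge has `2p` nodes, and the heights also add up to `2p`. -/
theorem beadDual_two_windows {p s₁ s₂ s₁' s₂' : ℕ} {f₁ f₂ g₁ g₂ : ℤ → ℤ}
    (hf₁ : IsRunner p s₁ f₁) (hf₂ : IsRunner p s₂ f₂) (hg₁ : IsRunner p s₁' g₁)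
    (hg₂ : IsRunner p s₂' g₂) (hs₁ : 0 < s₁) (hs₂ : 0 < s₂) (hs₁' : 0 < s₁') (hs₂' : 0 < s₂')
    (h₁ : s₁ + s₁' = p) (h₂ : s₂ + s₂' = p) {c c' α₁ α₂ β₁ β₂ : ℤ} (hc : c ≤ f₁ α₁)
    (hc' : c' ≤ g₁ β₁) (n : ℕ) (hf : ∀ j : ℕ, j < n → f₁ (α₁ + j) + p ≤ f₂ (α₂ + j))
    (hg : ∀ j : ℕ, j < n → g₁ (β₁ + j) + p ≤ g₂ (β₂ + j))
    (h : BeadDual p (Set.Iio c ∪ win f₁ α₁ s₁ ∪ win f₂ α₂ s₂)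
      (Set.Iio c' ∪ win g₁ β₁ s₁' ∪ win g₂ β₂ s₂')) :
    BeadDual p (Set.Iio c ∪ win f₁ (α₁ + n) s₁ ∪ win f₂ (α₂ + n) s₂)
      (Set.Iio c' ∪ win g₁ (β₁ + n) s₁' ∪ win g₂ (β₂ + n) s₂') := by
  induction n with
  | zero => simpa using h
  | succ n ih =>
    have h1 : c ≤ f₁ (α₁ + n) := hc.trans (hf₁.mono.monotone (by omega))
    have h2 : c' ≤ g₁ (β₁ + n) := hc'.trans (hg₁.mono.monotone (by omega))
    have h3 := edgeStep_two_windows hf₁ hf₂ hs₁ hs₂ (by omega) h1 (hf n (by omega))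
    have h4 := edgeStep_two_windows hg₁ hg₂ hs₁' hs₂' (by omega) h2 (hg n (by omega))
    rw [add_assoc, add_assoc] at h3 h4
    push_cast
    exact BeadDual.of_step h3 h4 (by rw [if_pos (dvd_add dvd_rfl dvd_rfl)]; omega)
      (ih (fun j hj => hf j (by omega)) fun j hj => hg j (by omega))

/-! ### Explicit runners -/

/-- The increasing enumeration of the integers `n` such that `n - a` has a remainder modulo `p` in
`[0, u) ∪ [u + v, s + v)`. -/
def run (p s : ℕ) (a : ℤ) (u v : ℕ) (n : ℤ) : ℤ :=
  a + n / s * p + n % s + if n % s < u then 0 else (v : ℤ)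

theorem run_eq {p s : ℕ} {a : ℤ} {u v : ℕ} {n : ℤ} (q r : ℤ) (hn : n = q * s + r) (h0 : 0 ≤ r)
    (hs : r < s) : run p s a u v n = a + q * p + r + if r < u then 0 else (v : ℤ) := by
  have h1 : n % s = r := by
    rw [hn, add_comm, Int.add_mul_emod_self_right, Int.emod_eq_of_lt h0 hs]
  have h2 : n / s = q := by
    rw [hn, add_comm, Int.add_mul_ediv_right _ _ (by omega), Int.ediv_eq_zero_of_lt h0 hs, zero_add]
  rw [run, h1, h2]

theorem isRunner_run {p s : ℕ} (a : ℤ) (u : ℕ) {v : ℕ} (hs : 0 < s) (h : s + v ≤ p) :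
    IsRunner p s (run p s a u v) := by
  refine ⟨strictMono_int_of_lt_succ fun n => ?_, fun n => ?_⟩
  · have h1 := Int.emod_nonneg n (show (s : ℤ) ≠ 0 by omega)
    have h2 := Int.emod_lt_of_pos n (show (0 : ℤ) < s by omega)
    have h3 : n = n / s * s + n % s := (Int.ediv_mul_add_emod n s).symm
    rw [run_eq (n / s) (n % s) h3 h1 h2]
    rcases lt_or_ge (n % s + 1) s with h4 | h4
    · rw [run_eq (n / s) (n % s + 1) (by linarith) (by omega) h4]
      split_ifs <;> omega
    · rw [run_eq (n / s + 1) 0 (by linarith) le_rfl (by omega), add_mul]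
      split_ifs <;> omega
  · have h1 := Int.emod_nonneg n (show (s : ℤ) ≠ 0 by omega)
    have h2 := Int.emod_lt_of_pos n (show (0 : ℤ) < s by omega)
    have h3 : n = n / s * s + n % s := (Int.ediv_mul_add_emod n s).symm
    rw [run_eq (n / s) (n % s) h3 h1 h2, run_eq (n / s + 1) (n % s) (by linarith) h1 h2]
    ring

/-- A window meets at most two periods: the residue indices from `r₀` on in period `q`, the earlier
ones in period `q + 1`. -/
theorem mem_win_run {p s : ℕ} {a : ℤ} {u v : ℕ} {y n : ℤ} (q r₀ : ℤ) (hy : y = q * s + r₀)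
    (h0 : 0 ≤ r₀) (hs : r₀ ≤ s) :
    n ∈ win (run p s a u v) y s ↔
      (∃ r, (r₀ ≤ r ∧ r < s) ∧ n = a + q * p + r + if r < u then 0 else (v : ℤ)) ∨
        ∃ r, (0 ≤ r ∧ r < r₀) ∧ n = a + (q + 1) * p + r + if r < u then 0 else (v : ℤ) := by
  rw [mem_win]
  constructor
  · rintro ⟨k, hk, rfl⟩
    rcases lt_or_ge (k - q * s) s with h | h
    · exact Or.inl ⟨k - q * s, by omega, run_eq q _ (by ring) (by omega) h⟩
    · refine Or.inr ⟨k - q * s - s, by omega, run_eq (q + 1) _ (by ring) (by omega) (by omega)⟩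
  · rintro (⟨r, hr, rfl⟩ | ⟨r, hr, rfl⟩)
    · exact ⟨q * s + r, by omega, run_eq q r rfl (by omega) (by omega)⟩
    · refine ⟨(q + 1) * s + r, ?_, run_eq (q + 1) r rfl (by omega) (by omega)⟩
      rw [add_mul, one_mul]
      omega

theorem mem_win_run_interval {p s : ℕ} {a : ℤ} {u : ℕ} {y n : ℤ} (q r₀ : ℤ)
    (hy : y = q * s + r₀) (h0 : 0 ≤ r₀) (hs : r₀ ≤ s) :
    n ∈ win (run p s a u 0) y s ↔
      (a + q * p + r₀ ≤ n ∧ n < a + q * p + s) ∨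
        (a + q * p + p ≤ n ∧ n < a + q * p + p + r₀) := by
  rw [mem_win_run q r₀ hy h0 hs]
  simp only [Nat.cast_zero, ite_self, add_zero, add_mul, one_mul]
  constructor
  · rintro (⟨r, hr, rfl⟩ | ⟨r, hr, rfl⟩)
    · left; omega
    · right; omega
  · rintro (h | h)
    · exact Or.inl ⟨n - (a + q * p), by omega, by omega⟩
    · exact Or.inr ⟨n - (a + q * p + p), by omega, by omega⟩

end Ptn

/-! ### The beads of the abaci in question -/

namespace Abacus

theorem nthBead_mem (L : Abacus) (k : ℕ) : L.nthBead k ∈ L.bead ∧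
    ∀ n ∈ L.bead, L.nthBead (k + 1) < n → n < L.nthBead k → False := by
  have hstep : ∀ a : ℤ, {n | n ∈ L.bead ∧ n < a}.Nonempty := fun a => by
    obtain ⟨N, h, -⟩ := L.bound
    exact ⟨min (-N) (a - 1), h _ (min_le_left _ _), lt_of_le_of_lt (min_le_right _ _) (by omega)⟩
  have hbdd : ∀ a : ℤ, BddAbove {n | n ∈ L.bead ∧ n < a} := fun a =>
    L.bddAbove.mono fun n hn => hn.1
  refine ⟨?_, fun n hn h1 h2 => ?_⟩
  · cases k with
    | zero => exact Int.csSup_mem ((hstep 0).mono fun n hn => hn.1) L.bddAbove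
    | succ k => exact (Int.csSup_mem (hstep (L.nthBead k)) (hbdd _)).1
  · exact absurd (le_csSup (hbdd (L.nthBead k)) ⟨hn, h2⟩) (not_le.2 h1)

/-- All integers strictly between consecutive beads are spaces, so bead gaps and differences of
parts agree up to one. -/
theorem nthBead_eq (L : Abacus) (k : ℕ) :
    L.nthBead k = L.toPtn.bd k + (L.nthBead 0 - L.toPtn.part 0) := by
  induction k with
  | zero => simp [Ptn.bd]
  | succ k ih =>
    have h1 := L.nthBead_succ_lt k
    have h2 := (L.nthBead_mem k).2
    have h3 := (L.nthBead_mem k).1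
    have h4 : {n | n ∉ L.bead ∧ n ≤ L.nthBead k} =
        {n | n ∉ L.bead ∧ n ≤ L.nthBead (k + 1)} ∪
          ↑(Finset.Ioo (L.nthBead (k + 1)) (L.nthBead k)) := by
      ext n
      simp only [Set.mem_ofPred_eq, Set.mem_union, Finset.mem_coe, Finset.mem_Ioo]
      constructor
      · rintro ⟨h5, h6⟩
        have : n ≠ L.nthBead k := by rintro rfl; exact h5 h3
        by_cases h7 : n ≤ L.nthBead (k + 1)
        · exact Or.inl ⟨h5, h7⟩
        · exact Or.inr (by omega)
      · rintro (⟨h5, h6⟩ | h5)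
        · exact ⟨h5, by omega⟩
        · exact ⟨fun h6 => h2 n h6 h5.1 h5.2, h5.2.le⟩
    have h5 : L.toPtn.part k = L.toPtn.part (k + 1) +
        (L.nthBead k - L.nthBead (k + 1) - 1).toNat := by
      simp only [toPtn]
      rw [h4, Set.ncard_union_eq _ (finite_spaces L _) (Finset.finite_toSet _),
        Set.ncard_coe_finset, Int.card_Ioo]
      rw [Set.disjoint_left]
      intro n hn hn'
      have := (Finset.mem_Ioo.1 (Finset.mem_coe.1 hn')).1
      have := hn.2
      omega
    simp only [Ptn.bd] at *
    push_cast
    omega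

theorem rep_toPtn (L : Abacus) : L.toPtn.Rep L.bead := by
  refine ⟨L.nthBead 0 - L.toPtn.part 0, fun n => ?_⟩
  simp_rw [← nthBead_eq]
  constructor
  · intro hn
    by_contra! h
    have h1 : ∀ k, n < L.nthBead k := fun k => by
      induction k with
      | zero => exact lt_of_le_of_ne (le_csSup L.bddAbove hn) (h 0)
      | succ k ih =>
        refine lt_of_le_of_ne ?_ (h _)
        by_contra h2
        exact (L.nthBead_mem k).2 n hn (by omega) ih
    have h2 := h1 (L.nthBead 0 - n).toNat
    have h3 := L.nthBead_le (L.nthBead 0 - n).toNat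
    omega
  · rintro ⟨k, rfl⟩
    exact (L.nthBead_mem k).1

end Abacus

namespace Ptn

theorem exists_rep (c : ℤ) (X : Finset ℤ) : ∃ l : Ptn, l.Rep (Set.Iio c ∪ X) := by
  obtain ⟨b, hb⟩ := X.bddAbove
  refine ⟨Abacus.toPtn ⟨Set.Iio c ∪ X, |b| + |c| + 1, fun n hn => Or.inl ?_, ?_⟩,
    Abacus.rep_toPtn _⟩
  · have := neg_abs_le c
    have := abs_nonneg b
    simp only [Set.mem_Iio]
    omega
  · have h1 := le_abs_self b
    have h2 := le_abs_self c
    have h3 := abs_nonneg b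
    have h4 := abs_nonneg c
    rintro n hn (h | h)
    · have : n < c := h
      omega
    · have : n ≤ b := hb h
      omega

end Ptn

/-- The number of smaller runner elements, used in `segment`, is the index in the enumeration `run`.
-/
theorem segment_eq {p i : ℕ} (hi : 0 < i) (hip : i ≤ p) (x : ℕ) :
    segment p 0 (Set.Ico 0 (i : ℤ)) x = Ptn.win (Ptn.run p i 0 0 0) x i := by
  have hf := Ptn.isRunner_run (p := p) (s := i) 0 0 (v := 0) hi (by omega)
  have hval : ∀ q r : ℤ, 0 ≤ r → r < i → Ptn.run p i 0 0 0 (q * i + r) = q * p + r :=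
    fun q r h0 h1 => by
      rw [Ptn.run_eq q r rfl h0 h1]
      simp
  have hf0 : Ptn.run p i 0 0 0 0 = 0 := by
    have := hval 0 0 le_rfl (by omega)
    simpa using this
  have hrun : ∀ n, n ∈ runners p 0 (Set.Ico 0 (i : ℤ)) ↔
      ∃ k : ℕ, n = Ptn.run p i 0 0 0 k := by
    intro n
    constructor
    · rintro ⟨h1, h2, h3⟩
      have h4 : 0 ≤ n / p := Int.ediv_nonneg h1 (by omega)
      have h5 : 0 ≤ n / p * i := mul_nonneg h4 (by omega)
      refine ⟨(n / p * i + n % p).toNat, ?_⟩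
      rw [Int.toNat_of_nonneg (by omega), hval _ _ h2 h3, Int.ediv_mul_add_emod]
    · rintro ⟨k, rfl⟩
      have h1 := Int.emod_nonneg k (show (i : ℤ) ≠ 0 by omega)
      have h2 := Int.emod_lt_of_pos k (show (0 : ℤ) < i by omega)
      refine ⟨?_, ?_⟩
      · exact hf0.symm.trans_le (hf.mono.monotone (by omega))
      · rw [← Int.ediv_mul_add_emod k i, hval _ _ h1 h2, add_comm,
          Int.add_mul_emod_self_right, Int.emod_eq_of_lt h1 (by omega)]
        exact ⟨h1, h2⟩
  have hcount : ∀ k : ℕ, Set.ncard {m | m ∈ runners p 0 (Set.Ico 0 (i : ℤ)) ∧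
      m < Ptn.run p i 0 0 0 k} = k := by
    intro k
    have : {m | m ∈ runners p 0 (Set.Ico 0 (i : ℤ)) ∧ m < Ptn.run p i 0 0 0 k} =
        ↑((Finset.range k).image fun j : ℕ => Ptn.run p i 0 0 0 j) := by
      ext m
      simp only [Set.mem_ofPred_eq, hrun, Finset.coe_image, Set.mem_image, Finset.mem_coe,
        Finset.mem_range]
      constructor
      · rintro ⟨⟨j, rfl⟩, h⟩
        have := hf.mono.lt_iff_lt.1 h
        exact ⟨j, by omega, rfl⟩
      · rintro ⟨j, hj, rfl⟩
        exact ⟨⟨j, rfl⟩, hf.mono (by omega)⟩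
    rw [this, Set.ncard_coe_finset, Finset.card_image_of_injective, Finset.card_range]
    intro a b hab
    have := hf.mono.injective hab
    omega
  have hS : (Set.Ico 0 (i : ℤ)).ncard = i := by
    rw [← Finset.coe_Ico, Set.ncard_coe_finset]
    simp
  ext n
  rw [Finset.mem_coe, Ptn.mem_win]
  constructor
  · rintro ⟨h1, h2⟩
    obtain ⟨k, rfl⟩ := (hrun n).1 h1
    rw [hcount, hS] at h2
    exact ⟨k, by omega, rfl⟩
  · rintro ⟨k, hk, rfl⟩
    lift k to ℕ using by omega
    refine ⟨(hrun _).2 ⟨k, rfl⟩, ?_⟩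
    rw [hcount, hS]
    omega

theorem rep_lam {p h i : ℕ} (hi : 0 < i) (hip : i ≤ p) (x : ℕ) :
    (lam p h i x).Rep
      (Set.Iio 0 ∪ Set.Ico (i : ℤ) h ∪ Ptn.win (Ptn.run p i 0 0 0) x i) := by
  rw [Set.union_right_comm, ← segment_eq hi hip]
  exact (lamAbacus p h i x).rep_toPtn

end Mullineux

/-! ### Bead sets of the two Mullineux images -/

namespace Mullineux
namespace Ptn

/-- The set of beads of the Mullineux image of `lam p h i x`. -/
theorem beadDual_lam {p h i x m d : ℕ} (hi : 0 < i) (hih : i ≤ h) (hix : i ≤ x) (hhp : h < p)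
    (hm : m = max i (i + h - x)) (hd : m + d = p) :
    BeadDual p (Set.Iio 0 ∪ Set.Ico (i : ℤ) h ∪ win (run p i 0 0 0) x i)
      (Set.Iio 0 ∪ Set.Ico ((h : ℤ) - m) h ∪ win (run p d h 0 0) ((x : ℤ) + m - h) d) := by
  have hf := isRunner_run (p := p) (s := i) 0 0 (v := 0) hi (by omega)
  have hg := isRunner_run (p := p) (s := d) h 0 (v := 0) (by omega) (by omega)
  have hfi : run p i 0 0 0 i = p := by
    rw [run_eq 1 0 (by ring) le_rfl (by omega)]
    simp
  have hg0 : run p d h 0 0 0 = h := by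
    rw [run_eq 0 0 (by ring) le_rfl (by omega)]
    simp
  -- Block steps run until the ray reaches one of the blocks, which start at `i` and at `h - m = min
  -- h x - i`. Here it is the first; what remains of the other block joins its window into a window
  -- on `p - i` runners.
  by_cases hcase : 2 * i ≤ min h x
  · have hf1 : (p : ℤ) ≤ run p i 0 0 0 (x - i) := hfi ▸ hf.mono.monotone (by omega)
    have hg1 : (h : ℤ) ≤ run p d h 0 0 (x + m - h - i) := by
      refine le_of_eq_of_le hg0.symm (hg.mono.monotone ?_)
      omega
    refine beadDual_block_windows hf hg hi (by omega) i (by omega) (by omega) (by omega)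
      (by omega) (by omega) (by omega) (by omega) (by omega) ?_
    have hg' := isRunner_run (p := p) (s := p - i) h 0 (v := 0) (by omega) (by omega)
    have hcast : ((p - i : ℕ) : ℤ) = p - i := by omega
    have e1 : (Set.Iio ((0 : ℤ) + i) ∪ Set.Ico (i : ℤ) (h - i) ∪
        win (run p i 0 0 0) (x - i) i : Set ℤ) =
        Set.Iio ((h : ℤ) - i) ∪ win (run p i 0 0 0) ((i : ℤ) + (x - 2 * i : ℕ)) i := by
      rw [show (i : ℤ) + (x - 2 * i : ℕ) = x - i by omega, zero_add,
        Set.Iio_union_Ico_eq_Iio (by omega)]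
    have e2 : (Set.Iio ((0 : ℤ) + i) ∪ Set.Ico ((h : ℤ) - m) (h - i) ∪
        win (run p d h 0 0) (x + m - h - i) d : Set ℤ) =
        Set.Iio (i : ℤ) ∪ win (run p (p - i) h 0 0) ((2 * i - h : ℤ) + (x - 2 * i : ℕ)) (p - i) := by
      rw [show (2 * i - h : ℤ) + (x - 2 * i : ℕ) = x - h by omega, zero_add]
      rcases Nat.lt_or_ge x h with hx | hx
      · ext n
        simp only [Set.mem_union, Set.mem_Iio, Set.mem_Ico, Finset.mem_coe]
        rw [mem_win_run_interval 0 0 (by omega) le_rfl (by omega),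
          mem_win_run_interval (-1) (p - i + x - h) (by omega) (by omega) (by omega)]
        omega
      · obtain rfl : m = i := by omega
        obtain rfl : d = p - m := by omega
        rw [show (x : ℤ) + m - h - m = x - h by ring, Set.Ico_self, Set.union_empty]
    rw [e1, e2]
    refine beadDual_windows hf hg' hi (by omega) (by omega) (κ := h + p - 1) ?_ ?_ ?_ ?_ _
    · rw [hfi]
      omega
    · rw [run_eq 0 (i - 1) (by ring) (by omega) (by omega)]
      simp
      omega
    · rcases Nat.lt_or_ge (2 * i) h with h2 | h2
      · rw [run_eq (-1) (p + i - h) (by omega) (by omega) (by omega)]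
        simp
        omega
      · rw [run_eq 0 0 (by omega) (by omega) (by omega)]
        simp
        omega
    · intro n
      simp only [Set.mem_union, Set.mem_Iio, Finset.mem_coe]
      rw [mem_win_run_interval (-1) (p + i - h) (by omega) (by omega) (by omega),
        mem_win_run_interval 1 0 (by omega) (by omega) (by omega)]
      omega
  -- Now the ray reaches the block of the image first, after `k` steps, and the other block joins
  -- its window into a window on `m` runners.
  · obtain ⟨k, hk⟩ : ∃ k, k + i = min h x := ⟨min h x - i, by omega⟩
    have hf1 : (p : ℤ) ≤ run p i 0 0 0 (x - k) := hfi ▸ hf.mono.monotone (by omega)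
    have hg1 : (h : ℤ) ≤ run p d h 0 0 (x + m - h - k) := by
      refine le_of_eq_of_le hg0.symm (hg.mono.monotone ?_)
      omega
    refine beadDual_block_windows hf hg hi (by omega) k (by omega) (by omega) (by omega)
      (by omega) (by omega) (by omega) (by omega) (by omega) ?_
    have hf' := isRunner_run (p := p) (s := m) 0 0 (v := 0) (by omega) (by omega)
    have hf'k : run p m 0 0 0 k = k := by
      rw [run_eq 0 k (by ring) (by omega) (by omega)]
      simp
    have e1 : (Set.Iio ((0 : ℤ) + k) ∪ Set.Ico (i : ℤ) (h - k) ∪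
        win (run p i 0 0 0) (x - k) i : Set ℤ) =
        Set.Iio (k : ℤ) ∪ win (run p m 0 0 0) ((k : ℤ) + (x - 2 * k : ℕ)) m := by
      rw [show (k : ℤ) + (x - 2 * k : ℕ) = x - k by omega, zero_add]
      rcases Nat.lt_or_ge x h with hx | hx
      · ext n
        simp only [Set.mem_union, Set.mem_Iio, Set.mem_Ico, Finset.mem_coe]
        rw [mem_win_run_interval 1 0 (by omega) le_rfl (by omega),
          mem_win_run_interval 0 i (by omega) (by omega) (by omega)]
        omega
      · obtain rfl : m = i := by omega
        rw [show (h : ℤ) - k = m by omega, Set.Ico_self, Set.union_empty]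
    have e2 : (Set.Iio ((0 : ℤ) + k) ∪ Set.Ico ((h : ℤ) - m) (h - k) ∪
        win (run p d h 0 0) (x + m - h - k) d : Set ℤ) =
        Set.Iio (m : ℤ) ∪ win (run p d h 0 0) ((0 : ℤ) + (x - 2 * k : ℕ)) d := by
      rw [show (0 : ℤ) + (x - 2 * k : ℕ) = x + m - h - k by omega, zero_add,
        show (h : ℤ) - m = k by omega, show (h : ℤ) - k = m by omega,
        Set.Iio_union_Ico_eq_Iio (by omega)]
    rw [e1, e2]
    refine beadDual_windows hf' hg (by omega) (by omega) hd (κ := h + p - 1) ?_ ?_ ?_ ?_ _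
    · rw [hf'k]
    · exact lt_of_lt_of_eq (hf'.mono (by omega)) hf'k
    · rw [hg0]
      omega
    · intro n
      simp only [Set.mem_union, Set.mem_Iio, Finset.mem_coe]
      rw [mem_win_run_interval 0 0 (by omega) (by omega) (by omega),
        mem_win_run_interval 0 k (by omega) (by omega) (by omega)]
      omega

theorem mem_win_run_gap {p s : ℕ} {a : ℤ} {u v : ℕ} {y n : ℤ} (hu : u ≤ s) (q r₀ : ℤ)
    (hy : y = q * s + r₀) (h0 : 0 ≤ r₀) (hs : r₀ ≤ s) :
    n ∈ win (run p s a u v) y s ↔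
      (a + q * p + r₀ ≤ n ∧ n < a + q * p + u) ∨
        (a + q * p + max r₀ u + v ≤ n ∧ n < a + q * p + s + v) ∨
          (a + q * p + p ≤ n ∧ n < a + q * p + p + min r₀ u) ∨
            (a + q * p + p + u + v ≤ n ∧ n < a + q * p + p + r₀ + v) := by
  rw [mem_win_run q r₀ hy h0 hs]
  simp only [add_mul, one_mul]
  constructor
  · rintro (⟨r, hr, rfl⟩ | ⟨r, hr, rfl⟩) <;> split_ifs <;> omega
  · rintro (h | h | h | h)
    · refine Or.inl ⟨n - (a + q * p), by omega, ?_⟩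
      rw [if_pos (by omega)]
      omega
    · refine Or.inl ⟨n - (a + q * p) - v, by omega, ?_⟩
      rw [if_neg (by omega)]
      omega
    · refine Or.inr ⟨n - (a + q * p + p), by omega, ?_⟩
      rw [if_pos (by omega)]
      omega
    · refine Or.inr ⟨n - (a + q * p + p) - v, by omega, ?_⟩
      rw [if_neg (by omega)]
      omega

theorem run_eq_add (p s : ℕ) (a : ℤ) (u v : ℕ) (n : ℤ) :
    run p s a u v n = a + n + n / s * (p - s) + if n % s < u then 0 else (v : ℤ) := by
  have := Int.ediv_mul_add_emod n s
  rw [run]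
  linear_combination this

/-- An enumeration with at most `p - 1` runners skips at least as much per index. This keeps the
lower window of the image below the upper one. -/
theorem run_le_run {p d : ℕ} (hd : 0 < d) (hdp : d < p) (r : ℕ) {n : ℤ} (hn : -1 ≤ n) :
    run p (p - 1) 1 0 0 n ≤ run p d 0 1 r (n + 1) := by
  have h1 : ((p - 1 : ℕ) : ℤ) = p - 1 := by omega
  rcases eq_or_lt_of_le hn with rfl | hn
  · rw [run_eq (-1) (p - 2) (by rw [h1]; ring) (by omega) (by omega),
      run_eq 0 0 (by ring) le_rfl (by omega)]
    simp
    omega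
  rw [run_eq_add, run_eq_add, h1]
  have h2 : 0 ≤ n / ((p : ℤ) - 1) := Int.ediv_nonneg (by omega) (by omega)
  have h3 : n / ((p : ℤ) - 1) ≤ (n + 1) / d := by
    refine Int.le_ediv_of_mul_le (by omega) ?_
    have h4 : n / ((p : ℤ) - 1) * (p - 1) ≤ n := Int.ediv_mul_le n (by omega)
    have h5 : n / ((p : ℤ) - 1) * d ≤ n / ((p : ℤ) - 1) * (p - 1) :=
      mul_le_mul_of_nonneg_left (by omega) h2
    omega
  have h6 : (n + 1) / d * 1 ≤ (n + 1) / d * ((p : ℤ) - d) :=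
    mul_le_mul_of_nonneg_left (by omega) (h2.trans h3)
  simp only [Nat.cast_zero, ite_self]
  split_ifs <;> linarith

end Ptn

/-- Here `H = s + 1` and `R = r + 1`. The top bead `Q * p + p + r` drops by `p` and the lowest
proper bead `Q * p + (r + 1)` rises by `p`. Runner `r` thus keeps a single low bead, and the other
`s` runners carry a full window. -/
theorem rep_lamTilde {p H x Q s r : ℕ} (hH : H = s + 1) (hsp : s + 1 < p) (hr : r < s)
    (hx : x = Q * H + (r + 1)) :
    (lamTilde p H x).Rep (Set.Iio 0 ∪ Ptn.win (Ptn.run p 1 r 0 0) Q 1 ∪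
      Ptn.win (Ptn.run p s 0 r 1) (Q * s + (r + 1)) s) := by
  have hmem : ∀ n, n ∈ (lamAbacus p H H x).bead ↔ n < 0 ∨
      (Q * p + (r + 1) ≤ n ∧ n < (Q * p : ℤ) + H) ∨
        (Q * p + p ≤ n ∧ n < (Q * p : ℤ) + p + (r + 1)) := by
    intro n
    change n ∈ Set.Iio 0 ∪ segment p 0 (Set.Ico 0 (H : ℤ)) x ∪ Set.Ico (H : ℤ) H ↔ _
    rw [segment_eq (by omega) (by omega), Set.Ico_self, Set.union_empty, Set.mem_union,
      Set.mem_Iio, Finset.mem_coe, Ptn.mem_win_run_interval Q (r + 1) (by rw [hx]; push_cast; ring)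
        (by omega) (by omega)]
    omega
  have hQp : (0 : ℤ) ≤ Q * p := by positivity
  have htop : (lamAbacus p H H x).topBead = Q * p + p + r := by
    refine IsGreatest.csSup_eq ⟨?_, fun n hn => ?_⟩
    · rw [hmem]
      omega
    · rw [hmem] at hn
      omega
  have hlow : (lamAbacus p H H x).lowBead = Q * p + (r + 1) := by
    refine IsLeast.csInf_eq ⟨⟨?_, 0, ?_, by omega⟩, ?_⟩
    · rw [hmem]
      omega
    · rw [hmem]
      omega
    · rintro n ⟨hn, b, hb, hbn⟩
      rw [hmem] at hn hb
      omega
  have h := ((lamAbacus p H H x).tilde p).rep_toPtn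
  suffices hB : (Set.Iio 0 ∪ Ptn.win (Ptn.run p 1 r 0 0) Q 1 ∪
      Ptn.win (Ptn.run p s 0 r 1) (Q * s + (r + 1)) s : Set ℤ) =
      ((lamAbacus p H H x).tilde p).bead by
    rw [hB]
    exact h
  ext n
  simp only [Abacus.tilde, htop, hlow, Set.mem_union, Set.mem_sdiff, Set.mem_insert_iff,
    Set.mem_singleton_iff, hmem, Finset.mem_coe, Set.mem_Iio]
  rw [Ptn.mem_win_run_interval Q 0 (by simp) (by omega) (by omega),
    Ptn.mem_win_run_gap hr.le Q (r + 1) rfl (by omega) (by omega)]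
  omega

namespace Ptn

/-- The set of beads of the Mullineux image of `lamTilde p H x`. -/
theorem beadDual_lamTilde {p s d r : ℕ} (Q : ℕ) (hsp : s + 1 < p) (hr : r < s) (hd : s + d = p) :
    BeadDual p
      (Set.Iio 0 ∪ win (run p 1 r 0 0) Q 1 ∪ win (run p s 0 r 1) (Q * s + (r + 1)) s)
      (Set.Iio ((r : ℤ) + 1 - p) ∪ win (run p (p - 1) 1 0 0) ((r : ℤ) + 1 - p + Q) (p - 1) ∪
        win (run p d 0 1 r) (Q * s + (r + 1)) d) := by
  have hf₁ := isRunner_run (p := p) (s := 1) r 0 (v := 0) (by omega) (by omega)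
  have hf := isRunner_run (p := p) (s := s) 0 r (v := 1) (by omega) (by omega)
  have hg₁ := isRunner_run (p := p) (s := p - 1) 1 0 (v := 0) (by omega) (by omega)
  have hg := isRunner_run (p := p) (s := d) 0 1 (v := r) (by omega) (by omega)
  have hp1 : ((p - 1 : ℕ) : ℤ) = p - 1 := by omega
  have hG1 : run p d 0 1 r 1 = r + 1 := by
    rw [run_eq 0 1 (by ring) (by omega) (by omega)]
    simp
    ring
  -- The index of the upper windows after `Q` common slides, which bring the low bead down to
  -- position `r`.
  obtain ⟨y, hy⟩ : ∃ y : ℤ, y = Q * s + (r + 1) - Q := ⟨_, rfl⟩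
  have hyj : ∀ j : ℕ, j ≤ Q → (j : ℤ) * s + (r + 1) - j ≤ y := fun j hj => by
    have h1 : (j : ℤ) * (s - 1) ≤ Q * (s - 1) :=
      mul_le_mul_of_nonneg_right (by omega) (by omega)
    rw [hy]
    linarith
  have hy0 : (r : ℤ) + 1 ≤ y := by
    have := hyj 0 (by omega)
    simpa using this
  have e0 : win (run p 1 r 0 0) Q 1 = win (run p 1 r 0 0) (0 + Q) 1 := by rw [zero_add]
  rw [show (Q : ℤ) * s + (r + 1) = y + Q by rw [hy]; ring, e0]
  refine beadDual_two_windows hf₁ hf hg₁ hg (by omega) (by omega) (by omega) (by omega)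
    (by omega) hd ?_ ?_ Q ?_ ?_ ?_
  · rw [run_eq 0 0 (by ring) le_rfl (by omega)]
    simp
  · rw [run_eq (-1) r (by rw [hp1]; ring) (by omega) (by omega)]
    simp
    omega
  · intro j hj
    have h1 := hyj (j + 1) (by omega)
    rw [run_eq j 0 (by simp) le_rfl (by omega)]
    refine le_trans ?_ (hf.mono.monotone (show ((j : ℤ) + 1) * s + r ≤ y + j by
      push_cast at h1
      linarith))
    rw [run_eq (j + 1) r rfl (by omega) (by omega), if_neg (by omega)]
    simp
    linarith
  · intro j hj
    rw [← hg₁.shift, hp1]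
    refine (run_le_run (d := d) (by omega) (by omega) r (by omega)).trans
      (hg.mono.monotone ?_)
    omega
  -- The lower windows have now become blocks: `{r}` and `[1, r + 1)` above the ray of negative
  -- integers.
  · have e1 : (Set.Iio 0 ∪ win (run p 1 r 0 0) 0 1 ∪ win (run p s 0 r 1) y s : Set ℤ) =
        Set.Iio 0 ∪ Set.Ico (r : ℤ) (r + 1) ∪ win (run p s 0 r 1) y s := by
      congr 2
      ext n
      rw [Finset.mem_coe, mem_win_run_interval 0 0 (by ring) le_rfl (by omega), Set.mem_Ico]
      omega
    have e2 : (Set.Iio ((r : ℤ) + 1 - p) ∪ win (run p (p - 1) 1 0 0) (r + 1 - p) (p - 1) ∪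
        win (run p d 0 1 r) y d : Set ℤ) =
        Set.Iio 0 ∪ Set.Ico 1 ((r : ℤ) + 1) ∪ win (run p d 0 1 r) y d := by
      congr 1
      ext n
      simp only [Set.mem_union, Set.mem_Iio, Set.mem_Ico, Finset.mem_coe]
      rw [mem_win_run_interval (-1) r (by rw [hp1]; ring) (by omega) (by omega)]
      omega
    rw [e1, e2]
    -- For `r = 0` the first block extends the ray and the second is empty. Otherwise one block step
    -- turns the two rays and blocks into the rays below `1` and below `r`.
    rcases Nat.eq_zero_or_pos r with rfl | hr0
    · have h := beadDual_windows hf hg (by omega) (by omega) hd (c := 1) (c' := 0) (α := 0)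
        (β := 0) (κ := p) ?_ ?_ ?_ ?_ y.toNat
      · rw [zero_add, Int.toNat_of_nonneg (by omega)] at h
        convert h using 2
        · ext n
          simp
        · ext n
          simp
      · rw [run_eq 0 0 (by ring) le_rfl (by omega)]
        simp
      · rw [run_eq (-1) (s - 1) (by ring) (by omega) (by omega)]
        split_ifs <;> omega
      · rw [run_eq 0 0 (by ring) le_rfl (by omega)]
        simp
      · intro n
        simp only [Set.mem_union, Set.mem_Iio, Finset.mem_coe]
        rw [mem_win_run_gap (by omega) 0 0 (by ring) le_rfl (by omega),
          mem_win_run_gap (by omega) 0 0 (by ring) le_rfl (by omega)]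
        omega
    · have hF : (r : ℤ) + 1 ≤ run p s 0 r 1 (y - (1 : ℕ)) := by
        refine le_trans ?_ (hf.mono.monotone (show (r : ℤ) ≤ y - (1 : ℕ) by omega))
        rw [run_eq 0 r (by ring) (by omega) (by omega), if_neg (by omega)]
        omega
      have hG : (r : ℤ) + 1 ≤ run p d 0 1 r (y - (1 : ℕ)) := by
        refine le_of_eq_of_le hG1.symm (hg.mono.monotone ?_)
        omega
      refine beadDual_block_windows hf hg (by omega) (by omega) 1 (by omega) (by omega)
        (by omega) (by omega) (by omega) (by omega) (by omega) (by omega) ?_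
      have h := beadDual_windows hf hg (by omega) (by omega) hd (c := 1) (c' := r) (α := 1)
        (β := 1) (κ := r + p) ?_ ?_ ?_ ?_ (y - 2).toNat
      · rw [show 1 + ((y - 2).toNat : ℤ) = y - (1 : ℕ) by omega] at h
        convert h using 2
        · ext n
          simp
        · ext n
          simp
          omega
      · rw [show (1 : ℤ) = 0 + 1 from rfl]
        refine Int.add_one_le_of_lt (lt_of_eq_of_lt ?_ (hf.mono (show (0 : ℤ) < 0 + 1 by omega)))
        rw [run_eq 0 0 (by ring) le_rfl (by omega), if_pos (by omega)]
        simp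
      · rw [run_eq 0 0 (by ring) le_rfl (by omega), if_pos (by omega)]
        simp
      · rw [hG1]
        omega
      · intro n
        simp only [Set.mem_union, Set.mem_Iio, Finset.mem_coe]
        rw [mem_win_run_gap (by omega) 0 1 (by ring) (by omega) (by omega),
          mem_win_run_gap (by omega) 0 1 (by ring) (by omega) (by omega)]
        omega

/-! ### Parts of partitions given by two windows of beads -/

/-- The beads in descending order are the upper window, the lower window and the ray; a part is the
bead minus the position it would have in the empty partition. -/
theorem Rep.parts {l : Ptn} {c y₁ y₂ : ℤ} {s₁ s₂ : ℕ} {f₁ f₂ : ℤ → ℤ} (hf₁ : StrictMono f₁)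
    (hf₂ : StrictMono f₂) (hc : c ≤ f₁ y₁) (hc₂ : c ≤ f₂ y₂) (h₁₂ : f₁ (y₁ + s₁ - 1) < f₂ y₂)
    (hl : Rep l (Set.Iio c ∪ win f₁ y₁ s₁ ∪ win f₂ y₂ s₂)) :
    (∀ k, k < s₂ → (l.part k : ℤ) = f₂ (y₂ + s₂ - 1 - k) - (c + s₁ + s₂ - 1 - k)) ∧
      (∀ k, s₂ ≤ k → k < s₂ + s₁ →
        (l.part k : ℤ) = f₁ (y₁ + s₁ + s₂ - 1 - k) - (c + s₁ + s₂ - 1 - k)) ∧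
      ∀ k, s₂ + s₁ ≤ k → l.part k = 0 := by
  obtain ⟨d, hd⟩ := hl
  set a : ℕ → ℤ := fun k => if k < s₂ then f₂ (y₂ + s₂ - 1 - k) else
    if k < s₂ + s₁ then f₁ (y₁ + s₁ + s₂ - 1 - k) else c + s₁ + s₂ - 1 - k with ha
  have ha_anti : StrictAnti a := by
    refine strictAnti_nat_of_succ_lt fun k => ?_
    simp only [ha]
    push_cast
    rcases Nat.lt_or_ge (k + 1) s₂ with h1 | h1
    · rw [if_pos h1, if_pos (by omega)]
      exact hf₂ (by omega)
    rcases Nat.lt_or_ge k s₂ with h2 | h2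
    · rw [if_neg (not_lt.2 h1), if_pos h2]
      have e1 : y₂ + s₂ - 1 - k = y₂ := by omega
      rw [e1]
      split_ifs
      · rwa [show y₁ + s₁ + s₂ - 1 - (k + 1) = y₁ + s₁ - 1 by omega]
      · omega
    rw [if_neg (not_lt.2 h1), if_neg (not_lt.2 h2)]
    rcases Nat.lt_or_ge (k + 1) (s₂ + s₁) with h3 | h3
    · rw [if_pos h3, if_pos (by omega)]
      exact hf₁ (by omega)
    rw [if_neg (not_lt.2 h3)]
    split_ifs with h4
    · have := hf₁.monotone (show y₁ ≤ y₁ + s₁ + s₂ - 1 - k by omega)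
      omega
    · omega
  have key := congrFun (eq_of_strictAnti (l.bd_add_strictAnti d) ha_anti fun n => by
    rw [← hd]
    simp only [Set.mem_union, Set.mem_Iio, Finset.mem_coe, mem_win, ha]
    constructor
    · rintro ((h | ⟨j, hj, rfl⟩) | ⟨j, hj, rfl⟩)
      · refine ⟨(c + s₁ + s₂ - 1 - n).toNat, ?_⟩
        rw [if_neg (by omega), if_neg (by omega)]
        omega
      · refine ⟨(y₁ + s₁ + s₂ - 1 - j).toNat, ?_⟩
        rw [if_neg (by omega), if_pos (by omega)]
        congr 1
        omega
      · refine ⟨(y₂ + s₂ - 1 - j).toNat, ?_⟩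
        rw [if_pos (by omega)]
        congr 1
        omega
    · rintro ⟨k, rfl⟩
      split_ifs
      · exact Or.inr ⟨_, by omega, rfl⟩
      · exact Or.inl (Or.inr ⟨_, by omega, rfl⟩)
      · left
        left
        omega)
  simp only [bd] at key
  -- The charge is read off at a row where both the part vanishes and the bead lies in the ray.
  have hd' : d = c + s₁ + s₂ - 1 := by
    have h := key (max l.height (s₂ + s₁))
    rw [(part_eq_zero_iff l _).2 (le_max_left _ _)] at h
    simp only [ha] at h
    rw [if_neg (by omega), if_neg (by omega)] at h
    omega
  subst hd'
  refine ⟨fun k hk => ?_, fun k hk hk' => ?_, fun k hk => ?_⟩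
  · have h := key k
    simp only [ha, if_pos hk] at h
    omega
  · have h := key k
    simp only [ha] at h
    rw [if_neg (by omega), if_pos hk'] at h
    omega
  · have h := key k
    simp only [ha] at h
    rw [if_neg (by omega), if_neg (by omega)] at h
    omega

/-- The parts of the Mullineux image of `lam p h i x`. -/
theorem parts_lam_image {l : Ptn} {p h x m d q r : ℕ} (hd : m + d = p) (hmh : m ≤ h)
    (hhx : h ≤ x + m) (hq : x + p = q * d + r + h + 1) (hr : r < d)
    (hl : Rep l (Set.Iio 0 ∪ Set.Ico ((h : ℤ) - m) h ∪ win (run p d h 0 0) ((x : ℤ) + m - h) d)) :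
    (∀ k, k ≤ r → l.part k = x + m * q) ∧
      (∀ k, r < k → k < d → l.part k + m = x + m * q) ∧
      (∀ k, d ≤ k → k < d + m → l.part k + m = h) ∧ ∀ k, d + m ≤ k → l.part k = 0 := by
  have hg := isRunner_run (p := p) (s := d) h 0 (v := 0) (by omega) (by omega)
  have hg0 : (h : ℤ) ≤ run p d h 0 0 ((x : ℤ) + m - h) := by
    refine le_of_eq_of_le ?_ (hg.mono.monotone (show (0 : ℤ) ≤ x + m - h by omega))
    rw [run_eq 0 0 (by ring) le_rfl (by omega)]
    simp
  have e1 : (Set.Ico ((h : ℤ) - m) h : Set ℤ) = win id ((h : ℤ) - m) m := by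
    ext n
    simp [win]
  rw [e1] at hl
  obtain ⟨h1, h2, h3⟩ := hl.parts strictMono_id hg.mono (by simp; omega) (by omega)
    (by simp only [id]; omega)
  -- The index of the top bead: `r + 1` beads lie in period `q`, the rest one period lower.
  have hq' : (x : ℤ) + m - h + d - 1 = q * d + r := by
    have : (x : ℤ) + p = q * d + r + h + 1 := by exact_mod_cast hq
    omega
  have hn : (q : ℤ) * p = m * q + q * d := by
    rw [← hd]
    push_cast
    ring
  refine ⟨fun k hk => ?_, fun k hk hk' => ?_, fun k hk hk' => ?_, h3⟩
  · have h4 := h1 k (by omega)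
    rw [run_eq q (r - k) (by linarith) (by omega) (by omega)] at h4
    simp only [Nat.cast_zero, ite_self] at h4
    have : (l.part k : ℤ) = x + m * q := by omega
    exact_mod_cast this
  · have h4 := h1 k (by omega)
    rw [run_eq (q - 1) (d + r - k) (by linarith) (by omega) (by omega), sub_mul] at h4
    simp only [Nat.cast_zero, ite_self] at h4
    have : (l.part k : ℤ) + m = x + m * q := by omega
    exact_mod_cast this
  · have h4 := h2 k hk hk'
    simp only [id] at h4
    omega

/-- The parts of the Mullineux image of `lamTilde p H x`. -/
theorem parts_lamTilde_image {l : Ptn} {p s d r Q q t q₁ r₁ : ℕ} (hsp : s + 1 < p) (hr : r < s)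
    (hd : s + d = p) (hq : Q * s + r + d = q * d + t) (ht : t < d)
    (hq₁ : r + Q + p = q₁ * (p - 1) + r₁ + 2) (hr₁ : r₁ < p - 1)
    (hl : Rep l (Set.Iio ((r : ℤ) + 1 - p) ∪
      win (run p (p - 1) 1 0 0) ((r : ℤ) + 1 - p + Q) (p - 1) ∪
        win (run p d 0 1 r) (Q * s + (r + 1)) d)) :
    (∀ k, k < t → (l.part k : ℤ) = q * p + t - d + 1) ∧
      ((l.part t : ℤ) = q * p + t - d + 1 - r) ∧
      (∀ k, t < k → k < d → (l.part k : ℤ) = q * p - p + t + 1) ∧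
      (∀ k, d ≤ k → k ≤ d + r₁ → (l.part k : ℤ) = q₁ * p - p + 2 + r₁ - r) ∧
      (∀ k, d + r₁ < k → k < d + (p - 1) → (l.part k : ℤ) = q₁ * p - p + 1 + r₁ - r) ∧
      (∀ k, d + (p - 1) ≤ k → l.part k = 0) ∧
      (q₁ * p - p + 1 + r₁ : ℤ) ≤ q * p - p + if t = 0 then 0 else (r : ℤ) + t := by
  have hp1 : ((p - 1 : ℕ) : ℤ) = p - 1 := by omega
  have hg₁ := isRunner_run (p := p) (s := p - 1) 1 0 (v := 0) (by omega) (by omega)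
  have hg := isRunner_run (p := p) (s := d) 0 1 (v := r) (by omega) (by omega)
  have hq' : (Q : ℤ) * s + r + d = q * d + t := by exact_mod_cast hq
  have hq₁' : (r : ℤ) + Q + p = q₁ * (p - 1) + r₁ + 2 := by
    rw [← hp1]
    exact_mod_cast hq₁
  have hQs : (Q : ℤ) * 1 ≤ Q * s := mul_le_mul_of_nonneg_left (by omega) (by omega)
  have hle : run p (p - 1) 1 0 0 ((r : ℤ) + Q - 1) ≤ run p d 0 1 r (Q * s + r) := by
    refine (run_le_run (d := d) (by omega) (by omega) r (by omega)).trans (hg.mono.monotone ?_)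
    linarith
  have hc₁ : (r : ℤ) + 1 - p ≤ run p (p - 1) 1 0 0 ((r : ℤ) + 1 - p + Q) := by
    refine le_of_eq_of_le ?_ (hg₁.mono.monotone (show (r : ℤ) + 1 - p ≤ _ by omega))
    rw [run_eq (-1) r (by rw [hp1]; ring) (by omega) (by omega)]
    simp
    ring
  have hc₂ : (r : ℤ) + 1 - p ≤ run p d 0 1 r (Q * s + (r + 1)) := by
    refine le_trans ?_ (hg.mono.monotone (show (0 : ℤ) ≤ Q * s + (r + 1) by positivity))
    rw [run_eq 0 0 (by ring) le_rfl (by omega)]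
    simp
    omega
  obtain ⟨h1, h2, h3⟩ := hl.parts hg₁.mono hg.mono hc₁ hc₂ (by
    rw [hp1, show (r : ℤ) + 1 - p + Q + (p - 1) - 1 = r + Q - 1 by ring]
    exact hle.trans_lt (hg.mono (by omega)))
  rw [hp1] at h1 h2
  refine ⟨fun k hk => ?_, ?_, fun k hk hk' => ?_, fun k hk hk' => ?_, fun k hk hk' => ?_, h3, ?_⟩
  · have h4 := h1 k (by omega)
    rw [run_eq q (t - k) (by linarith) (by omega) (by omega), if_neg (by omega)] at h4
    omega
  -- Row `t` holds the bead of residue `0`, below the gap of length `r` in its runner set; hence the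
  -- loss of `r`.
  · have h4 := h1 t ht
    rw [run_eq q 0 (by linarith) (by omega) (by omega), if_pos (by omega)] at h4
    omega
  · have h4 := h1 k (by omega)
    rw [run_eq (q - 1) (d + t - k) (by linarith) (by omega) (by omega), if_neg (by omega),
      sub_mul] at h4
    omega
  · have h4 := h2 k hk (by omega)
    rw [run_eq (q₁ - 1) (r₁ + d - k) (by rw [hp1]; linarith) (by omega) (by omega), sub_mul] at h4
    simp only [Nat.cast_zero, ite_self] at h4
    omega
  · have h4 := h2 k (by omega) (by omega)
    rw [run_eq (q₁ - 2) (p - 1 + r₁ + d - k) (by rw [hp1]; linarith) (by omega) (by omega),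
      sub_mul] at h4
    simp only [Nat.cast_zero, ite_self] at h4
    omega
  -- The top of the lower window against the runner element just below the upper window; regularity
  -- is deduced from this bound.
  · rw [run_eq (q₁ - 1) r₁ (by rw [hp1]; linarith) (by omega) (by omega),
      run_eq (q - 1) t (by linarith) (by omega) (by omega), sub_mul, sub_mul] at hle
    simp only [Nat.cast_zero, ite_self] at hle
    split_ifs at hle ⊢ <;> omega

/-! ### Regularity -/

/-- A nonzero value then occurs only within `p - 1` consecutive rows. -/
theorem isRegular_of_part_lt {p : ℕ} {l : Ptn} (hp : 0 < p)
    (h : ∀ k, 0 < l.part k → l.part (k + (p - 1)) < l.part k) : l.IsRegular p := by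
  intro a ha
  rcases Set.eq_empty_or_nonempty {k | l.part k = a} with h0 | h0
  · rw [h0, Set.ncard_empty]
    exact hp
  · have h1 : l.part (sInf {k | l.part k = a}) = a := Nat.sInf_mem h0
    have h2 := h _ (by rw [h1]; exact ha)
    have h3 : {k | l.part k = a} ⊆
        ↑(Finset.Ico (sInf {k | l.part k = a}) (sInf {k | l.part k = a} + (p - 1))) := by
      intro k hk
      rw [Finset.mem_coe, Finset.mem_Ico]
      refine ⟨Nat.sInf_le hk, ?_⟩
      by_contra h4
      have h5 := l.anti (not_lt.1 h4)
      have h6 : l.part k = a := hk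
      omega
    have h4 := Set.ncard_le_ncard h3 (Finset.finite_toSet _)
    rw [Set.ncard_coe_finset, Nat.card_Ico] at h4
    omega

/-! ### Dominance -/

theorem sum_range_add_const {F : ℕ → ℤ} {a : ℕ} (b : ℕ) {B : ℤ}
    (h : ∀ k, a ≤ k → k < a + b → F k = B) :
    ∑ k ∈ Finset.range (a + b), F k = ∑ k ∈ Finset.range a, F k + b * B := by
  induction b with
  | zero => simp
  | succ b ih =>
    rw [← add_assoc, Finset.sum_range_succ, ih fun k h1 h2 => h k h1 (by omega),
      h (a + b) (by omega) (by omega)]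
    push_cast
    ring

theorem sum_range_eq_of_zero {l : Ptn} {M N : ℕ} (hMN : M ≤ N)
    (h : ∀ k, M ≤ k → l.part k = 0) :
    ∑ k ∈ Finset.range N, l.part k = ∑ k ∈ Finset.range M, l.part k := by
  induction N, hMN using Nat.le_induction with
  | base => rfl
  | succ N hN ih => rw [Finset.sum_range_succ, ih, h N hN, add_zero]

/-- The difference of partial sums rises up to `K` and falls afterwards, so a negative value beyond
`K` would persist to the total. -/
theorem dominates_of_single_crossing {l m : Ptn} {K M : ℕ} (h1 : ∀ k, k < K → m.part k ≤ l.part k)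
    (h2 : ∀ k, K ≤ k → l.part k ≤ m.part k) (hl : ∀ k, M ≤ k → l.part k = 0)
    (hm : ∀ k, M ≤ k → m.part k = 0)
    (hs : ∑ k ∈ Finset.range M, m.part k ≤ ∑ k ∈ Finset.range M, l.part k) : l.Dominates m := by
  intro i
  rcases Nat.le_total i K with hi | hi
  · exact Finset.sum_le_sum fun k hk => h1 k (by have := Finset.mem_range.1 hk; omega)
  · by_contra! hlt
    have key : ∀ N, i ≤ N →
        ∑ k ∈ Finset.range N, l.part k < ∑ k ∈ Finset.range N, m.part k := by
      intro N hN
      induction N, hN using Nat.le_induction with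
      | base => exact hlt
      | succ N hN ih =>
        rw [Finset.sum_range_succ, Finset.sum_range_succ]
        exact add_lt_add_of_lt_of_le ih (h2 N (by omega))
    have h3 := key (max i M) (le_max_left _ _)
    rw [sum_range_eq_of_zero (le_max_right _ _) hl,
      sum_range_eq_of_zero (le_max_right _ _) hm] at h3
    omega

/-- At the first row where `l` is smaller, its part is at most `v - 1`; being nonincreasing, `l`
never exceeds `m` again. -/
theorem dominates_of_le_of_flat {l m : Ptn} {d M : ℕ} {v : ℤ}
    (h1 : ∀ k, k < d → m.part k ≤ l.part k)
    (h2 : ∀ k, d ≤ k → k < M → v - 1 ≤ m.part k ∧ (m.part k : ℤ) ≤ v)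
    (hl : ∀ k, M ≤ k → l.part k = 0) (hm : ∀ k, M ≤ k → m.part k = 0)
    (hs : ∑ k ∈ Finset.range M, m.part k ≤ ∑ k ∈ Finset.range M, l.part k) : l.Dominates m := by
  by_cases hex : ∃ k, l.part k < m.part k
  · have h3 := Nat.find_spec hex
    refine dominates_of_single_crossing (K := Nat.find hex)
      (fun k hk => not_lt.1 (Nat.find_min hex hk)) (fun k hk => ?_) hl hm hs
    have h4 : d ≤ Nat.find hex := by
      by_contra h
      have := h1 _ (not_le.1 h)
      omega
    have h5 : Nat.find hex < M := by
      by_contra h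
      have := hm _ (not_lt.1 h)
      omega
    rcases Nat.lt_or_ge k M with h6 | h6
    · have := h2 k (by omega) h6
      have := h2 _ h4 h5
      have := l.anti hk
      omega
    · rw [hl k h6]
      exact Nat.zero_le _
  · push Not at hex
    exact fun i => Finset.sum_le_sum fun k _ => hex k

/-! ### The two Mullineux images -/

/-- The Mullineux image of `lam p h i x`. -/
theorem exists_mullineux_lam {p h i x m d q r : ℕ} (hi : 0 < i) (hih : i ≤ h) (hix : i ≤ x)
    (hhp : h < p) (hm : m = max i (i + h - x)) (hd : m + d = p)
    (hq : x + p = q * d + r + h + 1) (hr : r < d) :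
    ∃ l, mullineux p (lam p h i x) = l ∧ (∀ k, k ≤ r → l.part k = x + m * q) ∧
      (∀ k, r < k → k < d → l.part k + m = x + m * q) ∧ (∀ k, p ≤ k → l.part k = 0) ∧
      ∀ M, p ≤ M → ((∑ k ∈ Finset.range M, l.part k : ℕ) : ℤ) = p * x := by
  obtain ⟨l, hl⟩ := exists_rep 0 (Finset.Ico ((h : ℤ) - m) h ∪
    win (run p d h 0 0) ((x : ℤ) + m - h) d)
  rw [Finset.coe_union, Finset.coe_Ico, ← Set.union_assoc] at hl
  obtain ⟨h1, h2, h3, h4⟩ := parts_lam_image hd (by omega) (by omega) hq hr hl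
  have hq1 : 1 ≤ q := by
    by_contra h
    obtain rfl : q = 0 := by omega
    omega
  have hmq : m * 1 ≤ m * q := Nat.mul_le_mul_left _ hq1
  refine ⟨l, mullineux_eq (by omega) (isRegular_of_part_lt (by omega) fun k hk => ?_)
    (beadDual_lam hi hih hix hhp hm hd _ _ (rep_lam hi (by omega) x) hl), h1, h2,
    fun k hk => h4 k (by omega), fun M hM => ?_⟩
  · rcases Nat.eq_zero_or_pos k with rfl | hk0
    · have h5 := h1 0 (by omega)
      have h6 := h3 (0 + (p - 1)) (by omega) (by omega)
      omega
    · rw [h4 _ (by omega)]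
      exact hk
  · rw [sum_range_eq_of_zero hM fun k hk => h4 k (by omega)]
    have hd' : (m : ℤ) + d = p := by exact_mod_cast hd
    have hq' : (x : ℤ) + p = q * d + r + h + 1 := by exact_mod_cast hq
    have e1 := sum_range_add_const (F := fun k => (l.part k : ℤ)) (a := 0) (r + 1)
      (B := x + m * q) fun k _ hk => by exact_mod_cast h1 k (by omega)
    have e2 := sum_range_add_const (F := fun k => (l.part k : ℤ)) (a := 0 + (r + 1)) (d - (r + 1))
      (B := x + m * q - m) fun k hk hk' => by
        have : (l.part k : ℤ) + m = x + m * q := by exact_mod_cast h2 k (by omega) (by omega)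
        omega
    have e3 := sum_range_add_const (F := fun k => (l.part k : ℤ)) (a := d) m
      (B := h - m) fun k hk hk' => by
        have := h3 k (by omega) (by omega)
        omega
    rw [show 0 + (r + 1) + (d - (r + 1)) = d by omega, e1] at e2
    rw [show d + m = p by omega, e2, Nat.cast_sub (by omega)] at e3
    rw [Nat.cast_sum, e3, Finset.sum_range_zero]
    push_cast
    rw [← hd'] at hq' ⊢
    linear_combination (-m : ℤ) * hq'

/-- The Mullineux image of `lamTilde p H x`. -/
theorem exists_mullineux_lamTilde {p H x Q s d r q t : ℕ} (hH : H = s + 1) (hsp : s + 1 < p)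
    (hr : r < s) (hd : s + d = p) (hx : x = Q * H + (r + 1)) (hq : Q * s + r + d = q * d + t)
    (ht : t < d) :
    ∃ (l : Ptn) (v : ℤ), mullineux p (lamTilde p H x) = l ∧
      (∀ k, k < t → (l.part k : ℤ) = q * p + t - d + 1) ∧
      ((l.part t : ℤ) = q * p + t - d + 1 - r) ∧
      (∀ k, t < k → k < d → (l.part k : ℤ) = q * p - p + t + 1) ∧
      (∀ k, d ≤ k → k < d + (p - 1) → v - 1 ≤ l.part k ∧ (l.part k : ℤ) ≤ v) ∧
      (∀ k, d + (p - 1) ≤ k → l.part k = 0) ∧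
      ((∑ k ∈ Finset.range (d + (p - 1)), l.part k : ℕ) : ℤ) = p * x := by
  obtain ⟨l, hl⟩ := exists_rep ((r : ℤ) + 1 - p)
    (win (run p (p - 1) 1 0 0) ((r : ℤ) + 1 - p + Q) (p - 1) ∪
      win (run p d 0 1 r) (Q * s + (r + 1)) d)
  rw [Finset.coe_union, ← Set.union_assoc] at hl
  obtain ⟨q₁, r₁, hq₁, hr₁⟩ : ∃ q₁ r₁, r + Q + p = q₁ * (p - 1) + r₁ + 2 ∧ r₁ < p - 1 := by
    refine ⟨(r + Q + p - 2) / (p - 1), (r + Q + p - 2) % (p - 1), ?_, Nat.mod_lt _ (by omega)⟩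
    have := Nat.div_add_mod' (r + Q + p - 2) (p - 1)
    omega
  obtain ⟨h1, h2, h3, h4, h5, h6, h7⟩ := parts_lamTilde_image hsp hr hd hq ht hq₁ hr₁ hl
  have hflat : ∀ k, d ≤ k → k < d + (p - 1) → (l.part k : ℤ) = q₁ * p - p + 2 + r₁ - r ∧ k ≤ d + r₁ ∨
      (l.part k : ℤ) = q₁ * p - p + 2 + r₁ - r - 1 := fun k hk hk' => by
    rcases Nat.lt_or_ge (d + r₁) k with h | h
    · have := h5 k h hk'
      omega
    · exact Or.inl ⟨h4 k hk h, h⟩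
  refine ⟨l, q₁ * p - p + 2 + r₁ - r, mullineux_eq (by omega)
    (isRegular_of_part_lt (by omega) fun k hk => ?_)
    (beadDual_lamTilde Q hsp hr hd _ _ (rep_lamTilde hH hsp hr hx) hl), h1, h2, h3,
    fun k hk hk' => ?_, h6, ?_⟩
  · rcases Nat.lt_or_ge k d with hkd | hkd
    · have h8 := hflat (k + (p - 1)) (by omega) (by omega)
      -- Distinct multiples of `p` differ by at least `p`; with the window bound `h7` this separates
      -- row `k` from the flat row `k + (p - 1)`.
      have h9 : (q₁ : ℤ) * p + p ≤ q * p ∨ (q₁ : ℤ) * p = q * p ∨ (q : ℤ) * p + p ≤ q₁ * p := by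
        rcases lt_trichotomy q₁ q with h | h | h
        · left
          have : ((q₁ : ℤ) + 1) * p ≤ q * p := mul_le_mul_of_nonneg_right (by omega) (by omega)
          linarith
        · exact Or.inr (Or.inl (by rw [h]))
        · right; right
          have : ((q : ℤ) + 1) * p ≤ q₁ * p := mul_le_mul_of_nonneg_right (by omega) (by omega)
          linarith
      rcases lt_trichotomy k t with h | rfl | h
      · have h10 := h1 k h
        split_ifs at h7 <;> omega
      · split_ifs at h7 <;> omega
      · have h10 := h3 k h hkd
        split_ifs at h7 <;> omega
    · rw [h6 _ (by omega)]
      exact hk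
  · have := hflat k hk hk'
    omega
  · have hd' : (s : ℤ) + d = p := by exact_mod_cast hd
    have hq' : (Q : ℤ) * s + r + d = q * d + t := by exact_mod_cast hq
    have hq₁' : (r : ℤ) + Q + p = q₁ * (p - 1) + r₁ + 2 := by
      rw [show (p : ℤ) - 1 = (p - 1 : ℕ) by omega]
      exact_mod_cast hq₁
    have e1 := sum_range_add_const (F := fun k => (l.part k : ℤ)) (a := 0) t
      (B := q * p + t - d + 1) fun k _ hk => h1 k (by omega)
    have e2 := sum_range_add_const (F := fun k => (l.part k : ℤ)) (a := t + 1) (d - (t + 1))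
      (B := q * p - p + t + 1) fun k hk hk' => h3 k (by omega) (by omega)
    have e3 := sum_range_add_const (F := fun k => (l.part k : ℤ)) (a := d) (r₁ + 1)
      (B := q₁ * p - p + 2 + r₁ - r) fun k hk hk' => h4 k (by omega) (by omega)
    have e4 := sum_range_add_const (F := fun k => (l.part k : ℤ)) (a := d + (r₁ + 1))
      (p - 1 - (r₁ + 1)) (B := q₁ * p - p + 1 + r₁ - r)
      fun k hk hk' => h5 k (by omega) (by omega)
    rw [show t + 1 + (d - (t + 1)) = d by omega, Finset.sum_range_succ, h2,
      Nat.cast_sub (by omega)] at e2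
    rw [zero_add] at e1
    rw [show d + (r₁ + 1) + (p - 1 - (r₁ + 1)) = d + (p - 1) by omega, e3, e2, e1,
      Nat.cast_sub (by omega), Nat.cast_sub (by omega)] at e4
    rw [Nat.cast_sum, e4, Finset.sum_range_zero, hx, hH]
    push_cast
    rw [← hd'] at hq₁' ⊢
    linear_combination (-(s + d : ℤ)) * hq' - (s + d : ℤ) * hq₁'

/-- Up to row `u`, `l` has not dropped. Beyond it `l` is lower by `m ≤ h`. If `t ≤ u < k`, then `l'`
has dropped by at least `h`. If `u < t`, the explicit first parts force `q' < q`, so row `0` leaves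
a margin greater than `h`. -/
theorem part_le_part_of_part_zero_le {l l' : Ptn} {p s d d' m h r u t q q' : ℕ} (hmh : m ≤ h)
    (hh : h + r = s) (hd : m + d = p) (hd' : s + d' = p) (hu : u < d) (ht : t < d')
    (h0 : (l.part 0 : ℤ) = q * p - p + h + 1 + u) (l1 : ∀ k, k ≤ u → l.part k = l.part 0)
    (l2 : ∀ k, u < k → k < d → l.part k + m = l.part 0)
    (k1 : ∀ k, k < t → (l'.part k : ℤ) = q' * p + t - d' + 1)
    (k2 : (l'.part t : ℤ) = q' * p + t - d' + 1 - r)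
    (k3 : ∀ k, t < k → k < d' → (l'.part k : ℤ) = q' * p - p + t + 1)
    (hle : l'.part 0 ≤ l.part 0) (k : ℕ) (hk : k < d') : l'.part k ≤ l.part k := by
  have h9 : (q : ℤ) * p + p ≤ q' * p ∨ (q : ℤ) * p = q' * p ∨ (q' : ℤ) * p + p ≤ q * p := by
    rcases lt_trichotomy q q' with h | h | h
    · left
      have : ((q : ℤ) + 1) * p ≤ q' * p := mul_le_mul_of_nonneg_right (by omega) (by omega)
      linarith
    · exact Or.inr (Or.inl (by rw [h]))
    · right; right
      have : ((q' : ℤ) + 1) * p ≤ q * p := mul_le_mul_of_nonneg_right (by omega) (by omega)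
      linarith
  have a0 := k1 0
  have a1 : t = 0 → (l'.part 0 : ℤ) = q' * p + t - d' + 1 - r := fun h0 => by
    rw [← k2, h0]
  have b1 := l1 k
  have b2 := l2 k
  clear l1 l2
  rcases lt_trichotomy k t with h | rfl | h
  · have := k1 k h
    clear k1 k2 k3
    omega
  · clear k1 k3
    omega
  · have := k3 k h hk
    clear k1 k2 k3
    omega

end Ptn

/-! ### Floor expressions and the final comparison -/

theorem floor_div_eq {a b : ℚ} {m n q r : ℤ} (ha : a = m) (hb : b = n) (h : m = q * n + r)
    (h0 : 0 ≤ r) (hr : r < n) : ⌊a / b⌋ = q := by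
  have hn : (0 : ℚ) < n := by exact_mod_cast h0.trans_lt hr
  have h0' : (0 : ℚ) ≤ r := by exact_mod_cast h0
  have hr' : (r : ℚ) < n := by exact_mod_cast hr
  have h' : (m : ℚ) = q * n + r := by exact_mod_cast h
  rw [ha, hb, Int.floor_eq_iff, le_div_iff₀ hn, div_lt_iff₀ hn, h']
  constructor
  · linarith
  · linarith

end Mullineux

theorem theorem6p8 (p : ℕ) (hp : p.Prime) (H x i : ℕ) (hH1 : 1 < H) (hHp : H < p)
    (hHx : ¬ H ∣ x) (Q R h : ℕ) (hQ : Q = x / H) (hR : R = x % H) (hh : h = H - R)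
    (hi : 0 < i) (hix : i ≤ x) (hih : i ≤ h)
    (m : ℤ) (hm : m = max (i : ℤ) ((i : ℤ) + h - x)) :
    (Mullineux.Ptn.mullineux p (Mullineux.lam p h i x)).Dominates
        (Mullineux.Ptn.mullineux p (Mullineux.lamTilde p H x)) ↔
      m * ⌊((p : ℚ) - h + x - 1) / ((p : ℚ) - m)⌋ ≥
        (H : ℤ) - Q - 1
          + (h : ℤ) * ⌊((x : ℚ) - Q - 1) / ((p : ℚ) - H + 1)⌋
          + ((R : ℤ) - 1) * ⌊((x : ℚ) - Q - 2) / ((p : ℚ) - H + 1)⌋ := by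
  have hR0 : R ≠ 0 := fun h0 => hHx (Nat.dvd_of_mod_eq_zero (hR ▸ h0))
  have hRH : R < H := hR ▸ Nat.mod_lt _ (by omega)
  have hxQ : x = Q * H + R := by rw [hQ, hR, Nat.div_add_mod']
  obtain ⟨s, rfl⟩ : ∃ s, H = s + 1 := ⟨H - 1, by omega⟩
  obtain ⟨r, rfl⟩ : ∃ r, R = r + 1 := ⟨R - 1, by omega⟩
  obtain ⟨μ, hμ⟩ : ∃ μ, μ = max i (i + h - x) := ⟨_, rfl⟩
  obtain rfl : m = μ := by omega
  obtain ⟨d, hd⟩ : ∃ d, μ + d = p := ⟨p - μ, by omega⟩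
  obtain ⟨d', hd'⟩ : ∃ d', s + d' = p := ⟨p - s, by omega⟩
  obtain ⟨q, u, hq, hu⟩ : ∃ q u, x + p = q * d + u + h + 1 ∧ u < d := by
    refine ⟨(x + p - h - 1) / d, (x + p - h - 1) % d, ?_, Nat.mod_lt _ (by omega)⟩
    have := Nat.div_add_mod' (x + p - h - 1) d
    omega
  -- The index of the top bead of the second image, divided by its number `d'` of upper runners; `q`
  -- and `u` are the analogues for the first image.
  obtain ⟨q', t, hq', ht⟩ : ∃ q' t, Q * s + r + d' = q' * d' + t ∧ t < d' :=
    ⟨_, _, (Nat.div_add_mod' _ _).symm, Nat.mod_lt _ (by omega)⟩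
  obtain ⟨l, hl, l1, l2, l3, l4⟩ :=
    Mullineux.Ptn.exists_mullineux_lam hi hih hix (by omega) hμ hd hq hu
  obtain ⟨l', v, hl', k1, k2, k3, k4, k5, k6⟩ :=
    Mullineux.Ptn.exists_mullineux_lamTilde rfl hHp (by omega) hd' hxQ hq' ht
  have zq : (x : ℤ) + p = q * d + u + h + 1 := by exact_mod_cast hq
  have zq' : (Q : ℤ) * s + r + d' = q' * d' + t := by exact_mod_cast hq'
  have zx : (x : ℤ) = Q * (s + 1) + (r + 1) := by exact_mod_cast hxQ
  have zd : (μ : ℤ) + d = p := by exact_mod_cast hd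
  have zd' : (s : ℤ) + d' = p := by exact_mod_cast hd'
  have zh : (h : ℤ) = s - r := by omega
  have hp0 : (l.part 0 : ℤ) = x + μ * q := by exact_mod_cast l1 0 (by omega)
  have hp0' : (l.part 0 : ℤ) = q * p - p + h + 1 + u := by
    rw [hp0, ← zd]
    rw [← zd] at zq
    linear_combination zq
  have f1 : ⌊((p : ℚ) - h + x - 1) / ((p : ℚ) - (μ : ℤ))⌋ = q :=
    Mullineux.floor_div_eq (m := p - h + x - 1) (n := p - μ) (r := u) (by push_cast; ring)
      (by push_cast; ring) (by rw [← zd] at zq ⊢; linear_combination zq) (by omega) (by omega)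
  have f2 : ⌊((x : ℚ) - Q - 1) / ((p : ℚ) - (s + 1 : ℕ) + 1)⌋ = q' - 1 :=
    Mullineux.floor_div_eq (m := x - Q - 1) (n := p - s) (r := t) (by push_cast; ring)
      (by push_cast; ring) (by rw [zx, ← zd']; linear_combination zq') (by omega) (by omega)
  have key : ((s + 1 : ℕ) : ℤ) - Q - 1
      + (h : ℤ) * ⌊((x : ℚ) - Q - 1) / ((p : ℚ) - (s + 1 : ℕ) + 1)⌋
      + (((r + 1 : ℕ) : ℤ) - 1) * ⌊((x : ℚ) - Q - 2) / ((p : ℚ) - (s + 1 : ℕ) + 1)⌋ =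
      l'.part 0 - x := by
    rw [f2]
    -- The second floor drops by one exactly when `t = 0`; its coefficient `R - 1 = r` matches the
    -- gap that then lowers the first part by `r`.
    rcases Nat.eq_zero_or_pos t with rfl | ht0
    · rw [Mullineux.floor_div_eq (m := x - Q - 2) (n := p - s) (q := q' - 2) (r := p - s - 1)
        (by push_cast; ring) (by push_cast; ring)
        (by rw [zx, ← zd']; linear_combination zq') (by omega) (by omega), k2, zh, zx, ← zd']
      push_cast
      linear_combination zq'
    · rw [Mullineux.floor_div_eq (m := x - Q - 2) (n := p - s) (q := q' - 1) (r := t - 1)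
        (by push_cast; ring) (by push_cast; ring)
        (by rw [zx, ← zd']; linear_combination zq') (by omega) (by omega), k1 0 ht0, zh, zx, ← zd']
      push_cast
      linear_combination zq'
  rw [key, f1, hl, hl', ge_iff_le, show (l'.part 0 : ℤ) - x ≤ μ * q ↔ l'.part 0 ≤ l.part 0 by omega]
  constructor
  · intro hdom
    simpa using hdom 1
  · intro hle
    refine Mullineux.Ptn.dominates_of_le_of_flat
      (Mullineux.Ptn.part_le_part_of_part_zero_le (by omega) (by omega) hd hd' hu ht hp0'
        (fun k hk => by rw [l1 k hk, l1 0 (by omega)])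
        (fun k hk hk' => by rw [l2 k hk hk', l1 0 (by omega)]) k1 k2 k3 hle) k4
      (fun k hk => l3 k (by omega)) k5 ?_
    have := l4 (d' + (p - 1)) (by omega)
    omega
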